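/- Let $\gamma\ge 0$ and $g$ be smooth $1$-periodic functions on $\mathbb R$, and set $\ell(t)=\sqrt{1+\gamma'(t)^2}$, $r=\int_0^1 \ell\,dt$, $\langle g\rangle=\frac1r\int_0^1 g\,\ell\,dt$, $\Sigma=\{\xi_2=\gamma(\xi_1)\}$. Let $\beta_0,\beta_1,\beta_2$ be the functions on $\{\xi_2\ge\gamma(\xi_1)\}$ that are $1$-periodic in $\xi_1$, $C^1$ up to $\Sigma$, harmonic in $\{\xi_2>\gamma(\xi_1)\}$, tend to $0$ as $\xi_2\to\infty$ (uniformly in $\xi_1$), and satisfy on $\Sigma$, with $n=(\gamma',-1)/\ell$ the outward unit normal, $$\partial_n\beta_0=g-\langle g\rangle,\qquad \partial_n\beta_1=-\frac{\gamma'}{\ell},\qquad \partial_n\beta_2=\frac1{\ell}-\frac1r .$$ Extend each $\beta_i$ to $\{\xi_2<\gamma(\xi_1)\}$ by reflection, $\beta_i(\xi_1,\xi_2)=\beta_i(\xi_1,2\gamma(\xi_1)-\xi_2)$. For $L>0$ let $\Omega_0=(0,L)^2$, $\Gamma_0=\partial\Omega_0\cap\{x_2=0\}$, $\Gamma_D=\partial\Omega_0\setminus\Gamma_0$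 and $V(\Omega_0)=\{v\in H^1(\Omega_0): v=0 \text{ on }\Gamma_D\}$. Let $f\in L^2(\Omega_0)$, $d\in H^1(\Omega_0)$, and let $u^0\in H^1(\Omega_0)$ be the solution of the homogenized problem: $u^0-d\in V(\Omega_0)$ and $$\int_{\Omega_0}\nabla u^0\cdot\nabla v\,dx=\int_{\Omega_0} f v\,dx+\int_{\Gamma_0} r\langle g\rangle v\,dx_1\qquad\text{for all } v\in V(\Omega_0)$$ (homogeneous Dirichlet data are the case $d=0$). Assume $\nabla u^0\in L^\infty(\Omega_0)$ and $\nabla^2u^0\in L^2(\Omega_0)$. For $\varepsilon>0$ put $$u^1(x)=\beta_0(x/\varepsilon)+\beta_1(x/\varepsilon)\,\partial_{x_1}u^0(x)+\beta_2(x/\varepsilon)\,\partial_{x_2}u^0(x),$$ and let $u^{\mathrm{cr}}\in H^1(\Omega_0)$ be the harmonic corrector: $u^{\mathrm{cr}}-u^1\in V(\Omega_0)$ and $\int_{\Omega_0}\nabla u^{\mathrm{cr}}\cdot\nabla v\,dx=0$ for all $v\in V(\Omega_0)$. Then $$\|\nabla u^{\mathrm{cr}}\|_{L^2(\Omega_0)}\le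 C\left(1+\|\nabla u^0\|_{L^\infty(\Omega_0)}+\|\nabla^2u^0\|_{L^2(\Omega_0)}\right),$$ where $C>0$ depends only on $\gamma$ and $g$; in particular it is independent of the size $L$ of $\Omega_0$ and of $\varepsilon$, $f$, $d$, $u^0$. -/

import Mathlib

open MeasureTheory Filter Topology InnerProductSpace
open scoped ENNReal NNReal ContDiff

noncomputable section

namespace RoughBoundary

/-- The Euclidean plane `ℝ²`; the coordinates `x₁, x₂` are `x 0, x 1`. -/
abbrev Plane : Type := EuclideanSpace ℝ (Fin 2)

/-! ## Sobolev functions -/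

/-- Smooth compactly supported functions on the plane. -/
def IsTest (φ : Plane → ℝ) : Prop := ContDiff ℝ ∞ φ ∧ HasCompactSupport φ

/-- `G` is the weak (distributional) gradient of `u` on the open set `Ω`. -/
structure IsWeakGrad (Ω : Set Plane) (u : Plane → ℝ) (G : Plane → Plane) : Prop where
  locallyIntegrable : LocallyIntegrableOn u Ω
  locallyIntegrable_grad : LocallyIntegrableOn G Ω
  integral_eq : ∀ φ : Plane → ℝ, IsTest φ → tsupport φ ⊆ Ω → ∀ i : Fin 2,
    ∫ x in Ω, u x * (gradient φ x) i = - ∫ x in Ω, (G x) i * φ x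

/-- `u ∈ H¹(Ω)` with weak gradient `G`. -/
structure MemH1 (Ω : Set Plane) (u : Plane → ℝ) (G : Plane → Plane) : Prop where
  memLp : MemLp u 2 (volume.restrict Ω)
  memLp_grad : MemLp G 2 (volume.restrict Ω)
  weakGrad : IsWeakGrad Ω u G

/-- `H` is the weak Hessian of a function with weak gradient `G`: row `j` of `H` is the weak
gradient of `∂ⱼu`. The norm on the values of `H` is the Frobenius norm. -/
def IsWeakHessian (Ω : Set Plane) (G : Plane → Plane)
    (H : Plane → PiLp 2 (fun _ : Fin 2 => Plane)) : Prop :=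
  ∀ j : Fin 2, IsWeakGrad Ω (fun x => (G x) j) (fun x => (H x) j)

/-! ## The homogenized domain of size `L` -/

/-- The square `Ω₀ = (0, L) × (0, L)`. -/
def square (L : ℝ) : Set Plane := {x | (0 < x 0 ∧ x 0 < L) ∧ (0 < x 1 ∧ x 1 < L)}

/-- The bottom side `Γ₀ = ∂Ω₀ ∩ {x₂ = 0}`. -/
def bottom (L : ℝ) : Set Plane := frontier (square L) ∩ {x | x 1 = 0}

/-- The Dirichlet part of the boundary, `Γ_D = ∂Ω₀ \ Γ₀`. -/
def dirichletPart (L : ℝ) : Set Plane := frontier (square L) \ bottom L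

/-- Smooth compactly supported functions on the plane that vanish near `Γ_D`. -/
def IsTestV (L : ℝ) (φ : Plane → ℝ) : Prop :=
  IsTest φ ∧ Disjoint (tsupport φ) (dirichletPart L)

/-- `v ∈ V(Ω₀) = {v ∈ H¹(Ω₀) : v = 0 on Γ_D}`, with weak gradient `G`. As usual the boundary
condition is expressed by `v` being in the `H¹(Ω₀)`-closure of the (restrictions to `Ω₀` of)
smooth functions that vanish near `Γ_D`. -/
def MemV (L : ℝ) (v : Plane → ℝ) (G : Plane → Plane) : Prop :=
  MemH1 (square L) v G ∧
  ∃ φ : ℕ → Plane → ℝ, (∀ n, IsTestV L (φ n)) ∧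
    Tendsto (fun n => eLpNorm (fun x => φ n x - v x) 2 (volume.restrict (square L)))
      atTop (𝓝 0) ∧
    Tendsto (fun n => eLpNorm (fun x => gradient (φ n) x - G x) 2 (volume.restrict (square L)))
      atTop (𝓝 0)

/-! ## The rough boundary and the cell problems -/

/-- The line element `√(1 + γ'(t)²)` of the curve `Σ = {ξ₂ = γ(ξ₁)}`. -/
def lineElt (γ : ℝ → ℝ) (t : ℝ) : ℝ := Real.sqrt (1 + deriv γ t ^ 2)

/-- The length `r` of one period of `Σ`. -/
def arcLen (γ : ℝ → ℝ) : ℝ := ∫ t in (0 : ℝ)..1, lineElt γ t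

/-- The mean `⟨g⟩` of `g` over one period of `Σ`. -/
def meanFlux (γ g : ℝ → ℝ) : ℝ := (arcLen γ)⁻¹ * ∫ t in (0 : ℝ)..1, g t * lineElt γ t

/-- The outward unit normal, at the point `(t, γ t)` of `Σ`, of the region above `Σ`. -/
def outNormal (γ : ℝ → ℝ) (t : ℝ) : Plane := !₂[deriv γ t / lineElt γ t, -1 / lineElt γ t]

/-- The open region above `Σ` (the periodic unfolding of the tube `Z_bl`). -/
def aboveOpen (γ : ℝ → ℝ) : Set Plane := {ξ | γ (ξ 0) < ξ 1}

/-- The region above `Σ`, with `Σ` included. -/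
def aboveClosed (γ : ℝ → ℝ) : Set Plane := {ξ | γ (ξ 0) ≤ ξ 1}

/-- `β` is a (classical) solution of the cell problem with Neumann datum `h`: it is `1`-periodic
in `ξ₁`, `C¹` up to `Σ`, harmonic above `Σ`, `∂β/∂n = h(ξ₁)` on `Σ`, and `β → 0` as `ξ₂ → ∞`
(uniformly in `ξ₁`). -/
structure IsCellSolution (γ h : ℝ → ℝ) (β : Plane → ℝ) : Prop where
  periodic : ∀ ξ ∈ aboveClosed γ, β (ξ + !₂[1, 0]) = β ξ
  contDiffOn : ContDiffOn ℝ 1 β (aboveClosed γ)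
  harmonic : HarmonicOnNhd β (aboveOpen γ)
  neumann : ∀ t : ℝ, fderivWithin ℝ β (aboveClosed γ) !₂[t, γ t] (outNormal γ t) = h t
  tendsto_zero : Tendsto β (comap (fun ξ : Plane => ξ 1) atTop) (𝓝 0)

/-- The three cell problems, which define `β₀`, `β₁` and `β₂`. -/
structure AreCellSolutions (γ g : ℝ → ℝ) (β₀ β₁ β₂ : Plane → ℝ) : Prop where
  zero : IsCellSolution γ (fun t => g t - meanFlux γ g) β₀
  one : IsCellSolution γ (fun t => -deriv γ t / lineElt γ t) β₁
  two : IsCellSolution γ (fun t => 1 / lineElt γ t - 1 / arcLen γ) β₂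

/-- Extension of a function given above `Σ` to the part of the plane below `Σ`, by vertical
reflection in `Σ`. -/
def reflectExt (γ : ℝ → ℝ) (β : Plane → ℝ) (ξ : Plane) : ℝ :=
  open Classical in
  if ξ ∈ aboveClosed γ then β ξ else β !₂[ξ 0, 2 * γ (ξ 0) - ξ 1]

/-- `u¹(x) = β₀(x/ε) + β₁(x/ε) ∂₁u⁰(x) + β₂(x/ε) ∂₂u⁰(x)`, where `G` is the gradient of `u⁰`
(and each `βᵢ` is extended below `Σ` by reflection). -/
def firstCorrection (γ : ℝ → ℝ) (ε : ℝ) (β₀ β₁ β₂ : Plane → ℝ) (G : Plane → Plane)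
    (x : Plane) : ℝ :=
  reflectExt γ β₀ (ε⁻¹ • x) + reflectExt γ β₁ (ε⁻¹ • x) * (G x) 0
    + reflectExt γ β₂ (ε⁻¹ • x) * (G x) 1

/-! ## The homogenized problem and the corrector problem -/

/-- `u` (with weak gradient `G`) is the weak solution of the homogenized problem
`-Δu = f` in `Ω₀`, `u = d` on `Γ_D`, `∂u/∂n = q` on `Γ₀`, with `d ∈ H¹(Ω₀)`. The variational
equation `∫ ∇u·∇v = ∫ f v + ∫_{Γ₀} q v` is tested with the smooth functions whose restrictions
are, by definition, dense in `V(Ω₀)`. -/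
structure IsHomogenized (L q : ℝ) (f d : Plane → ℝ) (u : Plane → ℝ) (G : Plane → Plane) :
    Prop where
  memH1 : MemH1 (square L) u G
  dirichlet : ∃ Gd : Plane → Plane, MemV L (fun x => u x - d x) Gd
  weak_eq : ∀ φ : Plane → ℝ, IsTestV L φ →
    ∫ x in square L, inner ℝ (G x) (gradient φ x) =
      (∫ x in square L, f x * φ x) + ∫ t in (0 : ℝ)..L, q * φ !₂[t, 0]

/-- `w` (with weak gradient `G`) is the harmonic corrector for the boundary values of `u₁`:
`w ∈ H¹(Ω₀)`, `w - u₁ ∈ V(Ω₀)` and `∫ ∇w·∇v = 0` for all `v ∈ V(Ω₀)`. -/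
structure IsCorrector (L : ℝ) (u₁ : Plane → ℝ) (w : Plane → ℝ) (G : Plane → Plane) :
    Prop where
  memH1 : MemH1 (square L) w G
  dirichlet : ∃ Gd : Plane → Plane, MemV L (fun x => w x - u₁ x) Gd
  weak_eq : ∀ (v : Plane → ℝ) (Gv : Plane → Plane), MemV L v Gv →
    ∫ x in square L, inner ℝ (G x) (Gv x) = 0

end RoughBoundary

end

open RoughBoundary

/-!
The energy of the harmonic corrector is at most the energy of any function with the same trace on
the Dirichlet part `Γ_D` of the boundary. The competitor is `η u₁`, where `η` is a cutoff which is
one near `Γ_D` and vanishes at distance `2ε` from it (`IsCorrector.eLpNorm_le`). Its gradient has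
size `(1/ε) exp (-x₂/ε) (1 + ‖∇u₀‖_∞)` within distance `2ε` of the lateral and top sides, up to a
term controlled by `∇²u₀` (`norm_layer_le`). Along the lateral sides the exponential restricts the
integral to a region of area of order `ε²`; along the top side `(L/ε) exp (-2L/ε)` is bounded. Hence
the `L²` norm is bounded independently of `ε` and `L` (`eLpNorm_layerWeight_le`).

The decay of the cell solutions is the only property of them that matters: `∂₁β - i∂₂β` is
holomorphic and `1`-periodic in a half-plane, and tends to zero at `+i∞` by the interior gradient
estimate, so it is a holomorphic function of `exp (2πiz)` vanishing at the origin
(`exists_exp_decay_of_periodic_harmonic`). Up to the curve the gradient is bounded because `β` is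
`C¹` there and periodic, and the extension by reflection is Lipschitz
(`IsCellSolution.exists_isDecaying`).

As the extension by reflection has a kink on the curve, weak gradients are tested with Lipschitz
functions (`IsWeakGrad.integral_eq_of_lipschitz`), which gives the product rule
`IsWeakGrad.lipschitz_mul` for `u₁`. That `(1 - η) u₁` is an admissible test function in the
equation of the corrector is `integral_inner_eq_zero_of_vanishing`: the function is extended by
zero, translated upwards and mollified, and translations are continuous in `L²`.
-/

namespace RoughBoundary

/-! ### Decay of periodic harmonic functions in a half-plane -/

/-- Interior gradient estimate. If `u = Re F` with `|u| ≤ s`, then `exp (F / s)` and its inverse are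
bounded by `e`, and Cauchy's estimate for `exp (F / s)` bounds `F'`. -/
lemma norm_fderiv_le_of_harmonicOnNhd_ball {u : ℂ → ℝ} {z : ℂ} {s : ℝ} (hs : 0 < s)
    (hu : HarmonicOnNhd u (Metric.ball z 1)) (hb : ∀ w ∈ Metric.ball z 1, |u w| ≤ s) :
    ‖fderiv ℝ u z‖ ≤ 2 * Real.exp 2 * s := by
  obtain ⟨F, hF, hre⟩ := hu.exists_analyticOnNhd_ball_re_eq
  have hz : z ∈ Metric.ball z 1 := Metric.mem_ball_self one_pos
  set E : ℂ → ℂ := fun w => Complex.exp (F w / s) with hE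
  have hnorm : ∀ w ∈ Metric.ball z 1, ‖E w‖ = Real.exp (u w / s) := by
    intro w hw
    have h1 : (F w).re = u w := hre hw
    simp only [hE, Complex.norm_exp, Complex.div_ofReal_re, h1]
  have hFd : ∀ w ∈ Metric.ball z 1, HasDerivAt F (deriv F w) w := fun w hw =>
    (hF w hw).differentiableAt.hasDerivAt
  have hEd : ∀ w ∈ Metric.ball z 1, HasDerivAt E (E w * (deriv F w / s)) w := fun w hw =>
    ((hFd w hw).div_const _).cexp
  have hsub : Metric.closedBall z (1 / 2) ⊆ Metric.ball z 1 :=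
    Metric.closedBall_subset_ball (by norm_num)
  have hcauchy : ‖deriv E z‖ ≤ Real.exp 1 / (1 / 2) := by
    refine Complex.norm_deriv_le_of_forall_mem_sphere_norm_le (by norm_num) ?_ ?_
    · refine DifferentiableOn.diffContOnCl fun w hw => ?_
      exact (hEd w (hsub (Metric.closure_ball_subset_closedBall hw))).differentiableAt
        |>.differentiableWithinAt
    · intro w hw
      have hw' := hsub (Metric.sphere_subset_closedBall hw)
      rw [hnorm w hw']
      exact Real.exp_le_exp.2 (by
        rw [div_le_one hs]; exact (le_abs_self _).trans (hb w hw'))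
  have hlow : Real.exp (-1) ≤ ‖E z‖ := by
    rw [hnorm z hz]
    refine Real.exp_le_exp.2 ?_
    rw [le_div_iff₀ hs]
    linarith [neg_abs_le (u z), hb z hz]
  have hF' : ‖deriv F z‖ ≤ 2 * Real.exp 2 * s := by
    rw [(hEd z hz).deriv, norm_mul, norm_div, Complex.norm_real, Real.norm_of_nonneg hs.le]
      at hcauchy
    have h1 : Real.exp (-1) * (‖deriv F z‖ / s) ≤ Real.exp 1 / (1 / 2) :=
      le_trans (by gcongr) hcauchy
    have h2 : Real.exp 2 = Real.exp 1 * Real.exp 1 := by rw [← Real.exp_add]; norm_num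
    have h3 : Real.exp 1 * Real.exp (-1) = 1 := by rw [← Real.exp_add]; norm_num
    have h4 : ‖deriv F z‖ / s ≤ 2 * Real.exp 2 := by
      calc ‖deriv F z‖ / s = Real.exp 1 * (Real.exp (-1) * (‖deriv F z‖ / s)) := by
            rw [← mul_assoc, h3, one_mul]
        _ ≤ Real.exp 1 * (Real.exp 1 / (1 / 2)) := by gcongr
        _ = 2 * Real.exp 2 := by rw [h2]; ring
    rwa [div_le_iff₀ hs] at h4
  have hfd : HasFDerivAt u (Complex.reCLM.comp
      ((ContinuousLinearMap.toSpanSingleton ℂ (deriv F z)).restrictScalars ℝ)) z := by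
    have h := Complex.reCLM.hasFDerivAt.comp z ((hFd z hz).hasFDerivAt.restrictScalars ℝ)
    refine h.congr_of_eventuallyEq ?_
    filter_upwards [Metric.isOpen_ball.mem_nhds hz] with w hw
    exact (hre hw).symm
  rw [hfd.fderiv]
  refine ContinuousLinearMap.opNorm_le_bound _ (by positivity) fun w => ?_
  simp only [ContinuousLinearMap.comp_apply, ContinuousLinearMap.coe_restrictScalars',
    ContinuousLinearMap.toSpanSingleton_apply, Complex.reCLM_apply, smul_eq_mul]
  refine (Complex.abs_re_le_norm _).trans ?_
  rw [norm_mul, mul_comm]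
  gcongr

/-- If `f' ≥ -K exp (-t)` then `f - K exp (-t)` is increasing, so it stays below its limit. -/
lemma le_exp_of_deriv_ge {f f' : ℝ → ℝ} {N K : ℝ}
    (hf : ∀ t, N ≤ t → HasDerivAt f (f' t) t) (hb : ∀ t, N ≤ t → -(K * Real.exp (-t)) ≤ f' t)
    (h0 : Tendsto f atTop (𝓝 0)) : ∀ t, N ≤ t → f t ≤ K * Real.exp (-t) := by
  have hd : ∀ t, N ≤ t → HasDerivAt (fun t => f t - K * Real.exp (-t))
      (f' t + K * Real.exp (-t)) t := by
    intro t ht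
    have h1 : HasDerivAt (fun t : ℝ => K * Real.exp (-t)) (K * (Real.exp (-t) * -1)) t :=
      ((hasDerivAt_neg t).exp).const_mul K
    convert! (hf t ht).sub h1 using 1
    ring
  have hmono : MonotoneOn (fun t => f t - K * Real.exp (-t)) (Set.Ici N) := by
    refine monotoneOn_of_deriv_nonneg (convex_Ici N)
      (fun t ht => (hd t ht).continuousAt.continuousWithinAt) ?_ ?_
    · intro t ht
      rw [interior_Ici] at ht
      exact (hd t (le_of_lt ht)).differentiableAt.differentiableWithinAt
    · intro t ht
      rw [interior_Ici] at ht
      rw [(hd t (le_of_lt ht)).deriv]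
      linarith [hb t (le_of_lt ht)]
  have hlim : Tendsto (fun t => f t - K * Real.exp (-t)) atTop (𝓝 0) := by
    simpa using h0.sub (Real.tendsto_exp_neg_atTop_nhds_zero.const_mul K)
  intro t ht
  have : f t - K * Real.exp (-t) ≤ 0 := by
    refine ge_of_tendsto hlim ?_
    filter_upwards [eventually_ge_atTop t] with s hs
    exact hmono ht (ht.trans hs) hs
  linarith

lemma abs_le_exp_of_deriv {f f' : ℝ → ℝ} {N K : ℝ}
    (hf : ∀ t, N ≤ t → HasDerivAt f (f' t) t) (hb : ∀ t, N ≤ t → |f' t| ≤ K * Real.exp (-t))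
    (h0 : Tendsto f atTop (𝓝 0)) : ∀ t, N ≤ t → |f t| ≤ K * Real.exp (-t) := by
  intro t ht
  refine abs_le'.2 ⟨le_exp_of_deriv_ge hf (fun t ht => (abs_le.1 (hb t ht)).1) h0 t ht, ?_⟩
  refine le_exp_of_deriv_ge (f := fun t => -f t) (f' := fun t => -f' t)
    (fun t ht => (hf t ht).neg) (fun t ht => ?_) (by simpa using h0.neg) t ht
  linarith [(abs_le.1 (hb t ht)).2]

/-- A periodic harmonic function in a half-plane which tends to zero at `+i∞` decays exponentially,
with its gradient: `∂₁u - i∂₂u` is holomorphic and periodic, hence a holomorphic function of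
`exp (2πiz)` vanishing at the origin. -/
theorem exists_exp_decay_of_periodic_harmonic {u : ℂ → ℝ} {M : ℝ}
    (hu : HarmonicOnNhd u {z | M < z.im}) (hper : ∀ z : ℂ, M < z.im → u (z + 1) = u z)
    (h0 : Tendsto u (comap Complex.im atTop) (𝓝 0)) :
    ∃ K N : ℝ, 0 ≤ K ∧ 0 ≤ N ∧ M < N ∧ ∀ z : ℂ, N ≤ z.im →
      |u z| ≤ K * Real.exp (-z.im) ∧ ‖fderiv ℝ u z‖ ≤ K * Real.exp (-z.im) := by
  have hopen : IsOpen {z : ℂ | M < z.im} := isOpen_lt continuous_const Complex.continuous_im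
  -- the gradient tends to zero
  have hgrad : ∀ e > 0, ∃ N, ∀ z : ℂ, N ≤ z.im → ‖fderiv ℝ u z‖ ≤ e := by
    intro e he
    set s := e / (2 * Real.exp 2) with hs
    have hs0 : 0 < s := by positivity
    have h1 : ∀ᶠ z in comap Complex.im atTop, |u z| ≤ s := by
      filter_upwards [h0 (Metric.ball_mem_nhds 0 hs0)] with z hz
      simpa using (Metric.mem_ball.1 hz).le
    rw [eventually_comap, eventually_atTop] at h1
    obtain ⟨N, hN⟩ := h1
    refine ⟨max N M + 1, fun z hz => ?_⟩
    have him : ∀ w ∈ Metric.ball z 1, max N M < w.im := by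
      intro w hw
      have h2 : |(w - z).im| < 1 :=
        (Complex.abs_im_le_norm _).trans_lt (by simpa [dist_eq_norm] using hw)
      rw [Complex.sub_im] at h2
      linarith [(abs_lt.1 h2).1]
    have := norm_fderiv_le_of_harmonicOnNhd_ball hs0
      (fun w hw => hu w ((le_max_right N M).trans_lt (him w hw)))
      (fun w hw => hN w.im ((le_max_left N M).trans (him w hw).le) w rfl)
    refine this.trans (le_of_eq ?_)
    rw [hs]; field_simp
  set G : ℂ → ℂ := fun z => open Classical in
    if M < z.im then (fderiv ℝ u z 1 - Complex.I * fderiv ℝ u z Complex.I : ℂ) else 0 with hG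
  have hGper : Function.Periodic G ((1 : ℝ) : ℂ) := by
    intro z
    simp only [hG, Complex.ofReal_one, Complex.add_im, Complex.one_im, add_zero]
    split_ifs with hz
    · have : fderiv ℝ u (z + 1) = fderiv ℝ u z := by
        rw [← fderiv_comp_add_right]
        refine Filter.EventuallyEq.fderiv_eq ?_
        filter_upwards [hopen.mem_nhds hz] with w hw using hper w hw
      rw [this]
    · rfl
  have hmem : ∀ N : ℝ, ∀ᶠ z in comap Complex.im atTop, N < z.im := fun N =>
    (eventually_gt_atTop N).comap _
  have hGhol : ∀ᶠ z in comap Complex.im atTop, DifferentiableAt ℂ G z := by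
    filter_upwards [hmem M] with z hz
    refine (HarmonicAt.differentiableAt_complex_partial (hu z hz)).congr_of_eventuallyEq ?_
    filter_upwards [hopen.mem_nhds hz] with w hw
    simp only [hG]
    exact if_pos hw
  have hGzero : (comap Complex.im atTop).ZeroAtFilter G := by
    refine Metric.tendsto_nhds.2 fun e he => ?_
    obtain ⟨N, hN⟩ := hgrad (e / 4) (by positivity)
    filter_upwards [hmem (max M N)] with z hz
    have hz1 := hN z ((le_max_right M N).trans hz.le)
    have hz2 : M < z.im := (le_max_left M N).trans_lt hz
    simp only [hG, if_pos hz2, dist_zero_right]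
    have h1 : ‖(fderiv ℝ u z 1 : ℂ)‖ ≤ e / 4 := by
      rw [Complex.norm_real]
      exact ((fderiv ℝ u z).le_opNorm 1).trans (by simpa using hz1)
    have h2 : ‖Complex.I * (fderiv ℝ u z Complex.I : ℂ)‖ ≤ e / 4 := by
      rw [norm_mul, Complex.norm_real]
      simpa using ((fderiv ℝ u z).le_opNorm Complex.I).trans (by simpa using hz1)
    linarith [norm_sub_le (fderiv ℝ u z 1 : ℂ) (Complex.I * (fderiv ℝ u z Complex.I : ℂ))]
  obtain ⟨c, hc⟩ :=
    (Function.Periodic.exp_decay_of_zero_at_inf one_pos hGper hGhol hGzero).bound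
  rw [eventually_comap, eventually_atTop] at hc
  obtain ⟨N₀, hN₀⟩ := hc
  set N := max (max N₀ (M + 1)) 0 with hN
  have hNN₀ : N₀ ≤ N := (le_max_left _ _).trans (le_max_left _ _)
  have hNM : M < N := by
    have : M + 1 ≤ N := (le_max_right _ _).trans (le_max_left _ _)
    linarith
  have hN0 : 0 ≤ N := le_max_right _ _
  set K := |c| * 2 with hK
  have hfd : ∀ z : ℂ, N ≤ z.im → ‖fderiv ℝ u z‖ ≤ K * Real.exp (-z.im) := by
    intro z hz
    have h1 := hN₀ z.im (hNN₀.trans hz) z rfl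
    have h2 : ‖G z‖ ≤ |c| * Real.exp (-z.im) := by
      refine h1.trans ?_
      rw [Real.norm_of_nonneg (Real.exp_nonneg _)]
      refine mul_le_mul (le_abs_self c) (Real.exp_le_exp.2 ?_) (Real.exp_nonneg _) (abs_nonneg c)
      nlinarith [Real.pi_gt_three, hN0.trans hz]
    have hGz : G z = (fderiv ℝ u z 1 - Complex.I * fderiv ℝ u z Complex.I : ℂ) :=
      if_pos (hNM.trans_le hz)
    have hre : |fderiv ℝ u z 1| ≤ |c| * Real.exp (-z.im) := by
      refine le_trans ?_ h2
      have := Complex.abs_re_le_norm (G z)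
      simpa [hGz] using this
    have him : |fderiv ℝ u z Complex.I| ≤ |c| * Real.exp (-z.im) := by
      refine le_trans ?_ h2
      have := Complex.abs_im_le_norm (G z)
      simpa [hGz] using this
    refine ContinuousLinearMap.opNorm_le_bound _ (by positivity) fun w => ?_
    have hw : fderiv ℝ u z w = w.re * fderiv ℝ u z 1 + w.im * fderiv ℝ u z Complex.I := by
      conv_lhs => rw [show w = w.re • (1 : ℂ) + w.im • Complex.I by
        simp [Complex.re_add_im]]
      rw [map_add, map_smul, map_smul, smul_eq_mul, smul_eq_mul]
    rw [hw]
    calc ‖w.re * fderiv ℝ u z 1 + w.im * fderiv ℝ u z Complex.I‖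
        ≤ |w.re| * |fderiv ℝ u z 1| + |w.im| * |fderiv ℝ u z Complex.I| := by
          rw [← abs_mul, ← abs_mul]; exact abs_add_le _ _
      _ ≤ ‖w‖ * (|c| * Real.exp (-z.im)) + ‖w‖ * (|c| * Real.exp (-z.im)) := by
          gcongr
          · exact Complex.abs_re_le_norm w
          · exact Complex.abs_im_le_norm w
      _ = K * Real.exp (-z.im) * ‖w‖ := by rw [hK]; ring
  refine ⟨K, N, by positivity, hN0, hNM, fun z hz => ⟨?_, hfd z hz⟩⟩
  have hline : ∀ t : ℝ, ((z.re : ℂ) + t * Complex.I).im = t := by intro t; simp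
  have hderiv : ∀ t, N ≤ t → HasDerivAt (fun t : ℝ => u (z.re + t * Complex.I))
      (fderiv ℝ u (z.re + t * Complex.I) Complex.I) t := by
    intro t ht
    have h1 : HasFDerivAt u (fderiv ℝ u (z.re + t * Complex.I)) (z.re + t * Complex.I) := by
      refine ((hu _ ?_).1.differentiableAt (by norm_num)).hasFDerivAt
      rw [Set.mem_ofPred_eq, hline]; exact hNM.trans_le ht
    have h2 : HasDerivAt (fun t : ℝ => (z.re : ℂ) + t * Complex.I) Complex.I t := by
      simpa using ((Complex.ofRealCLM.hasDerivAt (x := t)).mul_const Complex.I).const_add (z.re : ℂ)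
    exact h1.comp_hasDerivAt t h2
  have := abs_le_exp_of_deriv hderiv (K := K) (fun t ht => ?_) ?_ z.im hz
  · simpa [Complex.re_add_im] using this
  · have h1 := hfd (z.re + t * Complex.I) (by rw [hline]; exact ht)
    rw [hline] at h1
    refine le_trans ?_ h1
    simpa using (fderiv ℝ u (z.re + t * Complex.I)).le_opNorm Complex.I
  · refine h0.comp (tendsto_comap_iff.2 ?_)
    have : (Complex.im ∘ fun t : ℝ => (z.re : ℂ) + t * Complex.I) = id := by
      funext t; simp
    rw [this]; exact tendsto_id

/-! ### The cell solutions, extended by reflection -/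

lemma laplacian_comp_linearIsometryEquiv {E F : Type*} [NormedAddCommGroup E]
    [InnerProductSpace ℝ E] [FiniteDimensional ℝ E] [NormedAddCommGroup F] [InnerProductSpace ℝ F]
    [FiniteDimensional ℝ F] (e : E ≃ₗᵢ[ℝ] F) (f : F → ℝ) (z : E) :
    Laplacian.laplacian (f ∘ e) z = Laplacian.laplacian f (e z) := by
  have hit : ∀ v : E, iteratedFDeriv ℝ 2 (f ∘ e) z ![v, v] =
      iteratedFDeriv ℝ 2 f (e z) ![e v, e v] := by
    intro v
    have h := e.toContinuousLinearEquiv.iteratedFDerivWithin_comp_right f uniqueDiffOn_univ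
      (x := z) (Set.mem_univ _) 2
    rw [Set.preimage_univ, iteratedFDerivWithin_univ, iteratedFDerivWithin_univ] at h
    have h' := congrArg (fun T => T ![v, v]) h
    refine h'.trans ?_
    rw [ContinuousMultilinearMap.compContinuousLinearMap_apply]
    congr 1
    funext i
    fin_cases i <;> rfl
  rw [laplacian_eq_iteratedFDeriv_orthonormalBasis _ (stdOrthonormalBasis ℝ E),
    laplacian_eq_iteratedFDeriv_orthonormalBasis _ ((stdOrthonormalBasis ℝ E).map e)]
  simp only [hit, OrthonormalBasis.map_apply]

lemma HarmonicAt.comp_linearIsometryEquiv {E F : Type*} [NormedAddCommGroup E]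
    [InnerProductSpace ℝ E] [FiniteDimensional ℝ E] [NormedAddCommGroup F] [InnerProductSpace ℝ F]
    [FiniteDimensional ℝ F] (e : E ≃ₗᵢ[ℝ] F) {f : F → ℝ} {z : E} (hf : HarmonicAt f (e z)) :
    HarmonicAt (f ∘ e) z := by
  refine ⟨hf.1.comp z e.toContinuousLinearEquiv.contDiff.contDiffAt, ?_⟩
  filter_upwards [e.continuous.continuousAt.eventually hf.2] with w hw
  rw [laplacian_comp_linearIsometryEquiv, hw]
  rfl

variable {γ h : ℝ → ℝ} {β : Plane → ℝ}

lemma continuous_coord (i : Fin 2) : Continuous fun ξ : Plane => ξ i :=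
  (EuclideanSpace.proj (𝕜 := ℝ) i).continuous

lemma abs_coord_le (ξ : Plane) (i : Fin 2) : |ξ i| ≤ ‖ξ‖ := by
  simpa using PiLp.norm_apply_le ξ i

lemma norm_single_one (i : Fin 2) : ‖(EuclideanSpace.single i (1 : ℝ) : Plane)‖ = 1 := by
  simp

lemma isOpen_aboveOpen (hγ : Continuous γ) : IsOpen (aboveOpen γ) :=
  isOpen_lt (hγ.comp (continuous_coord 0)) (continuous_coord 1)

lemma aboveOpen_subset_aboveClosed : aboveOpen γ ⊆ aboveClosed γ :=
  fun ξ (h : γ (ξ 0) < ξ 1) => show γ (ξ 0) ≤ ξ 1 from h.le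

lemma IsCellSolution.exists_exp_decay (hβ : IsCellSolution γ h β) {M : ℝ} (hM : ∀ t, γ t ≤ M) :
    ∃ K N : ℝ, 0 ≤ K ∧ 0 ≤ N ∧ M < N ∧ ∀ ξ : Plane, N ≤ ξ 1 →
      |β ξ| ≤ K * Real.exp (-ξ 1) ∧ ‖fderiv ℝ β ξ‖ ≤ K * Real.exp (-ξ 1) := by
  set e : ℂ ≃ₗᵢ[ℝ] Plane := Complex.orthonormalBasisOneI.repr with he
  have he0 : ∀ z, e z 0 = z.re := fun z => by simp [he]
  have he1 : ∀ z, e z 1 = z.im := fun z => by simp [he]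
  have hmem : ∀ z : ℂ, M < z.im → e z ∈ aboveOpen γ := by
    intro z hz
    change γ (e z 0) < e z 1
    rw [he1]; exact (hM _).trans_lt hz
  obtain ⟨K, N, hK, hN, hMN, hdec⟩ :=
    exists_exp_decay_of_periodic_harmonic (u := β ∘ e) (M := M)
      (fun z hz => HarmonicAt.comp_linearIsometryEquiv e (hβ.harmonic _ (hmem z hz)))
      (fun z hz => by
        have h1 : e (z + 1) = e z + !₂[1, 0] := by
          ext i
          fin_cases i
          · simp [he0]
          · simp [he1]
        simp only [Function.comp_apply, h1]
        exact hβ.periodic _ (aboveOpen_subset_aboveClosed (hmem z hz)))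
      (hβ.tendsto_zero.comp (tendsto_comap_iff.2 (by
        have : ((fun ξ : Plane => ξ 1) ∘ e) = Complex.im := funext he1
        rw [this]; exact tendsto_comap)))
  refine ⟨K, N, hK, hN, hMN, fun ξ hξ => ?_⟩
  obtain ⟨z, rfl⟩ := e.surjective ξ
  rw [he1] at hξ ⊢
  refine ⟨(hdec z hξ).1, ?_⟩
  have h1 := (hdec z hξ).2
  have h2 : fderiv ℝ (β ∘ e) z = (fderiv ℝ β (e z)).comp (e : ℂ →L[ℝ] Plane) :=
    e.toContinuousLinearEquiv.comp_right_fderiv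
  refine ContinuousLinearMap.opNorm_le_bound _ (by positivity) fun w => ?_
  have h3 : fderiv ℝ β (e z) w = fderiv ℝ (β ∘ e) z (e.symm w) := by
    rw [h2]; simp
  rw [h3]
  refine ((fderiv ℝ (β ∘ e) z).le_opNorm _).trans ?_
  rw [e.symm.norm_map]
  gcongr

lemma IsCellSolution.fderiv_periodic (hγ : Continuous γ) (hper : Function.Periodic γ 1)
    (hβ : IsCellSolution γ h β) {ξ : Plane} (hξ : ξ ∈ aboveOpen γ) (n : ℤ) :
    fderiv ℝ β (ξ + (n : ℝ) • !₂[1, 0]) = fderiv ℝ β ξ := by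
  have hshift : ∀ (n : ℤ) (ξ : Plane), ξ ∈ aboveOpen γ →
      ξ + (n : ℝ) • !₂[1, 0] ∈ aboveOpen γ := by
    intro n ξ hξ
    have : γ (ξ 0 + n) = γ (ξ 0) := by simpa using hper.int_mul n (ξ 0)
    simpa [aboveOpen, this] using hξ
  have hone : ∀ ξ ∈ aboveOpen γ, fderiv ℝ β (ξ + !₂[1, 0]) = fderiv ℝ β ξ := by
    intro ξ hξ
    rw [← fderiv_comp_add_right]
    refine Filter.EventuallyEq.fderiv_eq ?_
    filter_upwards [(isOpen_aboveOpen hγ).mem_nhds hξ] with w hw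
      using hβ.periodic w (aboveOpen_subset_aboveClosed hw)
  induction n using Int.induction_on with
  | zero => simp
  | succ n ih =>
    rw [← ih, ← hone _ (hshift n ξ hξ)]
    congr 1
    push_cast
    module
  | pred n ih =>
    rw [← ih, ← hone _ (hshift _ ξ hξ)]
    congr 1
    push_cast
    module

/-- The gradient of a cell solution is bounded: near each point up to the curve because the
solution is `C¹` up to the curve, then on a period by compactness, and by decay at infinity. -/
lemma IsCellSolution.exists_fderiv_bound (hγ : Continuous γ) (hper : Function.Periodic γ 1)
    (hγ0 : ∀ t, 0 ≤ γ t) {M : ℝ} (hM : ∀ t, γ t ≤ M) (hβ : IsCellSolution γ h β) :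
    ∃ C : ℝ, 0 ≤ C ∧ ∀ ξ ∈ aboveOpen γ, ‖fderiv ℝ β ξ‖ ≤ C := by
  obtain ⟨K, N, hK, hN, hMN, hdec⟩ := hβ.exists_exp_decay hM
  have hclosed : IsClosed (aboveClosed γ) :=
    isClosed_le (hγ.comp (continuous_coord 0)) (continuous_coord 1)
  set S : Set Plane := {ξ | (0 ≤ ξ 0 ∧ ξ 0 ≤ 1) ∧ ξ 1 ≤ N} ∩ aboveClosed γ with hS
  have hScomp : IsCompact S := by
    refine Metric.isCompact_of_isClosed_isBounded ?_ ?_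
    · refine IsClosed.inter (((isClosed_le continuous_const (continuous_coord 0)).inter
        (isClosed_le (continuous_coord 0) continuous_const)).inter
        (isClosed_le (continuous_coord 1) continuous_const)) hclosed
    · refine (Metric.isBounded_iff_subset_closedBall 0).2 ⟨1 + N, fun ξ hξ => ?_⟩
      obtain ⟨⟨⟨h1, h2⟩, h3⟩, h4⟩ := hξ
      have h5 : 0 ≤ ξ 1 := (hγ0 _).trans h4
      rw [mem_closedBall_zero_iff, EuclideanSpace.norm_eq, Fin.sum_univ_two]
      refine Real.sqrt_le_iff.2 ⟨by linarith, ?_⟩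
      rw [Real.norm_eq_abs, Real.norm_eq_abs, sq_abs, sq_abs]
      nlinarith
  obtain ⟨C, hC⟩ : ∃ C : ℝ, ∀ ξ ∈ S, ξ ∈ aboveOpen γ → ‖fderiv ℝ β ξ‖ ≤ C := by
    refine hScomp.induction_on (p := fun T => ∃ C : ℝ, ∀ ξ ∈ T, ξ ∈ aboveOpen γ →
      ‖fderiv ℝ β ξ‖ ≤ C) ⟨0, by simp⟩ (fun s t hst ⟨C, hC⟩ => ⟨C, fun ξ hξ => hC ξ (hst hξ)⟩)
      (fun s t ⟨C, hC⟩ ⟨D, hD⟩ => ⟨max C D, fun ξ hξ ho => ?_⟩) (fun x hx => ?_)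
    · rcases hξ with hξ | hξ
      · exact (hC ξ hξ ho).trans (le_max_left _ _)
      · exact (hD ξ hξ ho).trans (le_max_right _ _)
    · have hcd : ContDiffWithinAt ℝ (0 + 1) β (aboveClosed γ) x := by
        simpa using hβ.contDiffOn x hx.2
      obtain ⟨u, hu, -, -, f', hf', hcont⟩ :=
        (contDiffWithinAt_succ_iff_hasFDerivWithinAt' (by simp)).1 hcd
      rw [Set.insert_eq_of_mem hx.2] at hu
      have hev : ∀ᶠ y in 𝓝[aboveClosed γ] x, ‖f' y‖ < ‖f' x‖ + 1 := by
        exact hcont.continuousWithinAt.norm.eventually (gt_mem_nhds (by linarith))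
      refine ⟨u ∩ {y | ‖f' y‖ < ‖f' x‖ + 1}, ?_, ‖f' x‖ + 1, ?_⟩
      · exact nhdsWithin_mono x Set.inter_subset_right (inter_mem hu hev)
      · rintro y ⟨hyu, hy⟩ hyo
        have h1 : HasFDerivAt β (f' y) y := (hf' y hyu).hasFDerivAt
          (mem_of_superset ((isOpen_aboveOpen hγ).mem_nhds hyo) aboveOpen_subset_aboveClosed)
        rw [h1.fderiv]
        exact le_of_lt hy
  refine ⟨max K (max C 0), (hK.trans (le_max_left _ _)), fun ξ hξ => ?_⟩
  rcases le_total N (ξ 1) with hN1 | hN1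
  · refine ((hdec ξ hN1).2.trans ?_).trans (le_max_left _ _)
    refine mul_le_of_le_one_right hK (Real.exp_le_one_iff.2 ?_)
    linarith
  · rw [← hβ.fderiv_periodic hγ hper hξ (-⌊ξ 0⌋)]
    have hγs : γ (ξ 0 + (-⌊ξ 0⌋ : ℤ)) = γ (ξ 0) := by
      simpa using hper.int_mul (-⌊ξ 0⌋) (ξ 0)
    have ho : ξ + ((-⌊ξ 0⌋ : ℤ) : ℝ) • !₂[1, 0] ∈ aboveOpen γ := by
      change γ _ < _
      have h0 : (ξ + ((-⌊ξ 0⌋ : ℤ) : ℝ) • !₂[1, 0] : Plane) 0 = ξ 0 + (-⌊ξ 0⌋ : ℤ) := by simp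
      have h1 : (ξ + ((-⌊ξ 0⌋ : ℤ) : ℝ) • !₂[1, 0] : Plane) 1 = ξ 1 := by simp
      rw [h0, h1, hγs]
      exact hξ
    refine (hC _ ⟨⟨?_, ?_⟩, aboveOpen_subset_aboveClosed ho⟩ ho).trans
      ((le_max_left _ _).trans (le_max_right _ _))
    · simp only [PiLp.add_apply, PiLp.smul_apply, Matrix.cons_val_zero, smul_eq_mul, mul_one,
        Int.cast_neg]
      constructor
      · linarith [Int.floor_le (ξ 0)]
      · linarith [Int.lt_floor_add_one (ξ 0)]
    · simpa using hN1

/-- The shear `(s, t) ↦ (s, t + k(s))`. -/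
def shear (k : ℝ → ℝ) (ξ : Plane) : Plane := ξ + k (ξ 0) • !₂[0, 1]

lemma shear_zero (k : ℝ → ℝ) (ξ : Plane) : shear k ξ 0 = ξ 0 := by simp [shear]

lemma shear_one (k : ℝ → ℝ) (ξ : Plane) : shear k ξ 1 = ξ 1 + k (ξ 0) := by simp [shear]

lemma lipschitzWith_coord (i : Fin 2) : LipschitzWith 1 fun ξ : Plane => ξ i :=
  LipschitzWith.of_dist_le_mul fun ξ ζ => by
    simpa [dist_eq_norm] using abs_coord_le (ξ - ζ) i

lemma lipschitzWith_shear {k : ℝ → ℝ} {K : ℝ≥0} (hk : LipschitzWith K k) :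
    LipschitzWith (1 + K) (shear k) := by
  refine LipschitzWith.id.add ?_
  refine LipschitzWith.of_dist_le_mul fun ξ ζ => ?_
  have h1 : ‖(!₂[0, 1] : Plane)‖ = 1 := by simp [EuclideanSpace.norm_eq]
  rw [dist_eq_norm, ← sub_smul, norm_smul, h1, mul_one, ← dist_eq_norm]
  simpa using (hk.comp (lipschitzWith_coord 0)).dist_le_mul ξ ζ

lemma lipschitzWith_of_smooth_periodic {k : ℝ → ℝ} (hk : ContDiff ℝ ∞ k)
    (hper : Function.Periodic k 1) : ∃ K : ℝ≥0, LipschitzWith K k := by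
  have hd : Continuous (deriv k) := hk.continuous_deriv (by simp)
  have hdper : Function.Periodic (deriv k) 1 := fun t => by
    rw [← deriv_comp_add_const]
    congr 1
    exact funext hper
  obtain ⟨C, hC⟩ := (isCompact_Icc (a := (0 : ℝ)) (b := 1)).exists_bound_of_continuousOn
    hd.continuousOn
  refine ⟨C.toNNReal, lipschitzWith_of_nnnorm_deriv_le (hk.differentiable (by simp)) fun t => ?_⟩
  obtain ⟨s, hs, hts⟩ := hdper.exists_mem_Ico₀ one_pos t
  rw [hts, ← NNReal.coe_le_coe, coe_nnnorm]
  exact (hC s ⟨hs.1, hs.2.le⟩).trans (Real.le_coe_toNNReal C)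

lemma exists_bound_of_continuous_periodic {k : ℝ → ℝ} (hk : Continuous k)
    (hper : Function.Periodic k 1) : ∃ M : ℝ, ∀ t, k t ≤ M := by
  obtain ⟨C, hC⟩ := (isCompact_Icc (a := (0 : ℝ)) (b := 1)).exists_bound_of_continuousOn
    hk.continuousOn
  refine ⟨C, fun t => ?_⟩
  obtain ⟨s, hs, hts⟩ := hper.exists_mem_Ico₀ one_pos t
  rw [hts]
  exact (le_abs_self _).trans (hC s ⟨hs.1, hs.2.le⟩)

/-- The extension by reflection is Lipschitz: after straightening the curve by a shear it is the
even extension of a function on a half-plane with bounded gradient. -/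
lemma IsCellSolution.lipschitzWith_reflectExt (hγ : ContDiff ℝ ∞ γ)
    (hper : Function.Periodic γ 1) (hγ0 : ∀ t, 0 ≤ γ t) (hβ : IsCellSolution γ h β) :
    ∃ K : ℝ≥0, LipschitzWith K (reflectExt γ β) := by
  obtain ⟨Kγ, hKγ⟩ := lipschitzWith_of_smooth_periodic hγ hper
  obtain ⟨M, hM⟩ := exists_bound_of_continuous_periodic hγ.continuous hper
  obtain ⟨C, hC0, hC⟩ := hβ.exists_fderiv_bound hγ.continuous hper hγ0 hM
  have hΦd : Differentiable ℝ (shear γ) := by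
    have h1 : Differentiable ℝ γ := hγ.differentiable (by simp)
    have h2 : Differentiable ℝ fun ξ : Plane => ξ 0 :=
      (EuclideanSpace.proj (𝕜 := ℝ) (0 : Fin 2)).differentiable
    exact differentiable_id.add ((h1.comp h2).smul_const _)
  have hΦL := lipschitzWith_shear hKγ
  have hmem : ∀ ζ : Plane, 0 < ζ 1 → shear γ ζ ∈ aboveOpen γ := by
    intro ζ hζ
    change γ _ < _
    rw [shear_zero, shear_one]; linarith
  have hmem' : ∀ ζ : Plane, 0 ≤ ζ 1 → shear γ ζ ∈ aboveClosed γ := by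
    intro ζ hζ
    change γ _ ≤ _
    rw [shear_zero, shear_one]; linarith
  set H : Set Plane := {ζ | 0 < ζ 1} with hH
  have hHconv : Convex ℝ H :=
    (convex_Ioi (0 : ℝ)).linear_preimage (EuclideanSpace.proj (𝕜 := ℝ) (1 : Fin 2)).toLinearMap
  have hHclos : closure H ⊆ {ζ | 0 ≤ ζ 1} :=
    closure_minimal (fun ζ (hζ : 0 < ζ 1) => show 0 ≤ ζ 1 from hζ.le)
      (isClosed_le continuous_const (continuous_coord 1))
  have hHclos' : {ζ : Plane | 0 ≤ ζ 1} ⊆ closure H := by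
    intro ζ hζ
    have ht : Tendsto (fun n : ℕ => ζ + (1 / ((n : ℝ) + 1)) • (!₂[0, 1] : Plane)) atTop
        (𝓝 (ζ + (0 : ℝ) • !₂[0, 1])) :=
      tendsto_const_nhds.add (tendsto_one_div_add_atTop_nhds_zero_nat.smul_const _)
    rw [zero_smul, add_zero] at ht
    refine mem_closure_of_tendsto ht (Eventually.of_forall fun n => ?_)
    have h1 : (0 : ℝ) < 1 / ((n : ℝ) + 1) := by positivity
    have h2 : (ζ + (1 / ((n : ℝ) + 1)) • (!₂[0, 1] : Plane)) 1 = ζ 1 + 1 / ((n : ℝ) + 1) := by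
      simp
    have h3 : 0 ≤ ζ 1 := hζ
    rw [hH, Set.mem_ofPred_eq, h2]
    linarith
  have hLip : LipschitzOnWith (C.toNNReal * (1 + Kγ)) (β ∘ shear γ) H := by
    refine hHconv.lipschitzOnWith_of_nnnorm_fderiv_le (𝕜 := ℝ) (fun ζ hζ => ?_) (fun ζ hζ => ?_)
    · exact ((hβ.harmonic _ (hmem ζ hζ)).1.differentiableAt (by norm_num)).comp ζ (hΦd ζ)
    · rw [fderiv_comp ζ ((hβ.harmonic _ (hmem ζ hζ)).1.differentiableAt (by norm_num)) (hΦd ζ)]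
      rw [← NNReal.coe_le_coe, coe_nnnorm, NNReal.coe_mul, Real.coe_toNNReal C hC0]
      refine (ContinuousLinearMap.opNorm_comp_le _ _).trans ?_
      exact mul_le_mul (hC _ (hmem ζ hζ)) (norm_fderiv_le_of_lipschitz ℝ hΦL) (norm_nonneg _) hC0
  have hLipc : LipschitzOnWith (C.toNNReal * (1 + Kγ)) (β ∘ shear γ) {ζ : Plane | 0 ≤ ζ 1} := by
    refine (LipschitzOnWith.closure ?_ hLip).mono hHclos'
    exact hβ.contDiffOn.continuousOn.comp hΦL.continuous.continuousOn
      fun ζ hζ => hmem' ζ (hHclos hζ)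
  set A : Plane → Plane := fun ζ => !₂[ζ 0, |ζ 1|] with hA
  have hAL : LipschitzWith 1 A := by
    refine LipschitzWith.of_dist_le_mul fun ξ ζ => ?_
    rw [NNReal.coe_one, one_mul, EuclideanSpace.dist_eq, EuclideanSpace.dist_eq]
    refine Real.sqrt_le_sqrt ?_
    simp only [Fin.sum_univ_two, hA, Real.dist_eq]
    have : |(|ξ 1| - |ζ 1|)| ^ 2 ≤ |ξ 1 - ζ 1| ^ 2 := by
      exact pow_le_pow_left₀ (abs_nonneg _) (abs_abs_sub_abs_le_abs_sub _ _) 2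
    simpa using this
  have hΨL : LipschitzWith (1 + Kγ) (shear fun t => -γ t) := lipschitzWith_shear hKγ.neg
  have hcomp : LipschitzWith (C.toNNReal * (1 + Kγ)) ((β ∘ shear γ) ∘ A) := by
    have h1 := hLipc.comp (f := A) (s := Set.univ) hAL.lipschitzOnWith
      (fun ζ _ => by simp [hA])
    rw [mul_one] at h1
    exact lipschitzOnWith_univ.1 h1
  have heq : reflectExt γ β = ((β ∘ shear γ) ∘ A) ∘ shear fun t => -γ t := by
    funext ξ
    have hval : shear γ (A (shear (fun t => -γ t) ξ)) =
        !₂[ξ 0, |ξ 1 - γ (ξ 0)| + γ (ξ 0)] := by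
      ext i
      fin_cases i
      · simp [shear, hA]
      · simp [shear, hA, sub_eq_add_neg]
    simp only [Function.comp_apply, hval, reflectExt]
    split_ifs with hξ
    · have h1 : γ (ξ 0) ≤ ξ 1 := hξ
      rw [abs_of_nonneg (by linarith)]
      congr 1
      ext i
      fin_cases i <;> simp
    · have h1 : ξ 1 < γ (ξ 0) := not_le.1 hξ
      rw [abs_of_neg (by linarith)]
      congr 1
      ext i
      fin_cases i
      · simp
      · simp; ring
  exact ⟨_, heq ▸ hcomp.comp hΨL⟩

/-- The function `b` is Lipschitz, and on the upper half-plane `b` and its directional derivatives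
along the coordinate axes are bounded by `K exp (-ξ₂)`. -/
structure IsDecaying (K : ℝ≥0) (b : Plane → ℝ) : Prop where
  lipschitz : LipschitzWith K b
  abs_le : ∀ ξ : Plane, 0 ≤ ξ 1 → |b ξ| ≤ K * Real.exp (-ξ 1)
  lineDeriv_le : ∀ (ξ : Plane) (i : Fin 2), 0 ≤ ξ 1 →
    |lineDeriv ℝ b ξ (EuclideanSpace.single i 1)| ≤ K * Real.exp (-ξ 1)

lemma IsDecaying.mono {K K' : ℝ≥0} {b : Plane → ℝ} (hb : IsDecaying K b) (hK : K ≤ K') :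
    IsDecaying K' b where
  lipschitz := hb.lipschitz.weaken hK
  abs_le ξ hξ := (hb.abs_le ξ hξ).trans (by gcongr)
  lineDeriv_le ξ i hξ := (hb.lineDeriv_le ξ i hξ).trans (by gcongr)

theorem IsCellSolution.exists_isDecaying (hγ : ContDiff ℝ ∞ γ)
    (hper : Function.Periodic γ 1) (hγ0 : ∀ t, 0 ≤ γ t) (hβ : IsCellSolution γ h β) :
    ∃ K : ℝ≥0, IsDecaying K (reflectExt γ β) := by
  obtain ⟨M, hM⟩ := exists_bound_of_continuous_periodic hγ.continuous hper
  obtain ⟨K, N, hK, hN, hMN, hdec⟩ := hβ.exists_exp_decay hM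
  obtain ⟨Λ, hΛ⟩ := hβ.lipschitzWith_reflectExt hγ hper hγ0
  have heq : ∀ ξ : Plane, N ≤ ξ 1 → reflectExt γ β ξ = β ξ := fun ξ hξ =>
    if_pos (show γ (ξ 0) ≤ ξ 1 by linarith [hM (ξ 0)])
  have heq' : ∀ ξ : Plane, N ≤ ξ 1 → reflectExt γ β =ᶠ[𝓝 ξ] β := by
    intro ξ hξ
    have hM1 : M < ξ 1 := by linarith
    filter_upwards [(isOpen_lt continuous_const (continuous_coord 1)).mem_nhds hM1] with ζ hζ
    exact if_pos (show γ (ζ 0) ≤ ζ 1 from (hM _).trans (le_of_lt hζ))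
  -- above height `N` the decay has the constant `K`; below, `b` is at most `K + Λ N` by vertical
  -- comparison with height `N`, its derivatives are at most `Λ`, and `exp (N - ξ₂) ≥ 1`
  set K₁ : ℝ := K + (K + Λ * N + Λ) * Real.exp N with hK₁
  have hle1 : K ≤ K₁ := by
    rw [hK₁]; nlinarith [Real.exp_pos N, Λ.coe_nonneg, mul_nonneg Λ.coe_nonneg hN,
      mul_nonneg (add_nonneg (add_nonneg hK (mul_nonneg Λ.coe_nonneg hN)) Λ.coe_nonneg)
        (Real.exp_pos N).le]
  have hΛK : (Λ : ℝ) ≤ K₁ := by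
    have h1 : 1 ≤ Real.exp N := Real.one_le_exp hN
    have h2 := mul_nonneg Λ.coe_nonneg hN
    have h3 : (K + Λ * N + Λ) * 1 ≤ (K + Λ * N + Λ) * Real.exp N :=
      mul_le_mul_of_nonneg_left h1 (by linarith [Λ.coe_nonneg])
    rw [hK₁]; linarith [Λ.coe_nonneg]
  -- below height `N` a constant is bounded by a multiple of the exponential
  have hlow : ∀ (ξ : Plane) (a : ℝ), ξ 1 ≤ N → a ≤ K + Λ * N + Λ →
      a ≤ K₁ * Real.exp (-ξ 1) := by
    intro ξ a hξ ha
    have h2 := mul_nonneg Λ.coe_nonneg hN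
    have h0 : 0 ≤ K + Λ * N + Λ := by linarith [Λ.coe_nonneg]
    have h1 : 1 ≤ Real.exp (N + -ξ 1) := Real.one_le_exp (by linarith)
    calc a ≤ (K + Λ * N + Λ) * 1 := by linarith
      _ ≤ (K + Λ * N + Λ) * Real.exp (N + -ξ 1) := mul_le_mul_of_nonneg_left h1 h0
      _ = (K + Λ * N + Λ) * Real.exp N * Real.exp (-ξ 1) := by rw [Real.exp_add]; ring
      _ ≤ K₁ * Real.exp (-ξ 1) := by
        refine mul_le_mul_of_nonneg_right ?_ (Real.exp_nonneg _)
        rw [hK₁]; linarith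
  have hK₁0 : 0 ≤ K₁ := hK.trans hle1
  refine ⟨⟨K₁, hK₁0⟩, hΛ.weaken hΛK, fun ξ hξ => ?_, fun ξ i hξ => ?_⟩
  · change _ ≤ K₁ * _
    rcases le_total N (ξ 1) with hN1 | hN1
    · rw [heq ξ hN1]
      exact (hdec ξ hN1).1.trans (by gcongr)
    · refine hlow ξ _ hN1 ?_
      set ζ : Plane := !₂[ξ 0, N] with hζ
      have h1 : |reflectExt γ β ζ| ≤ K := by
        have hζN : N ≤ ζ 1 := by simp [hζ]
        rw [heq ζ hζN]
        refine (hdec ζ hζN).1.trans (mul_le_of_le_one_right hK (Real.exp_le_one_iff.2 ?_))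
        linarith
      have h2 : dist ξ ζ = N - ξ 1 := by
        rw [EuclideanSpace.dist_eq, Fin.sum_univ_two]
        simpa [hζ, Real.dist_eq, Real.sqrt_sq_eq_abs, abs_of_nonpos (show ξ 1 - N ≤ 0 by linarith)]
          using hN1
      have h3 : |reflectExt γ β ξ - reflectExt γ β ζ| ≤ Λ * N := by
        rw [← Real.dist_eq]
        refine (hΛ.dist_le_mul ξ ζ).trans ?_
        rw [h2]
        exact mul_le_mul_of_nonneg_left (by linarith) Λ.coe_nonneg
      have h4 := abs_sub_abs_le_abs_sub (reflectExt γ β ξ) (reflectExt γ β ζ)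
      linarith [Λ.coe_nonneg]
  · change _ ≤ K₁ * _
    rcases le_total N (ξ 1) with hN1 | hN1
    · have hd : DifferentiableAt ℝ β ξ := (hβ.harmonic ξ
        (show γ (ξ 0) < ξ 1 by linarith [hM (ξ 0)])).1.differentiableAt (by norm_num)
      rw [(heq' ξ hN1).lineDeriv_eq, hd.lineDeriv_eq_fderiv]
      refine ((fderiv ℝ β ξ).le_opNorm _).trans ?_
      rw [norm_single_one, mul_one]
      exact (hdec ξ hN1).2.trans (by gcongr)
    · refine hlow ξ _ hN1 ?_
      have h1 := norm_lineDeriv_le_of_lipschitz ℝ hΛ (x₀ := ξ)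
        (v := EuclideanSpace.single i (1 : ℝ))
      rw [norm_single_one, mul_one, Real.norm_eq_abs] at h1
      linarith [mul_nonneg Λ.coe_nonneg hN]

/-! ### Lipschitz functions and mollification -/

/-- The `i`-th partial derivative, as a directional derivative. It makes sense almost everywhere
for Lipschitz functions. -/
noncomputable def partialDeriv (i : Fin 2) (f : Plane → ℝ) (x : Plane) : ℝ :=
  lineDeriv ℝ f x (EuclideanSpace.single i 1)

/-- The gradient of a Lipschitz function, defined almost everywhere through the partial
derivatives. -/
noncomputable def lipGrad (f : Plane → ℝ) (x : Plane) : Plane :=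
  WithLp.toLp 2 fun i => partialDeriv i f x

@[simp] lemma lipGrad_apply (f : Plane → ℝ) (x : Plane) (i : Fin 2) :
    lipGrad f x i = partialDeriv i f x := rfl

lemma gradient_apply_eq_partialDeriv {f : Plane → ℝ} {x : Plane} (hf : DifferentiableAt ℝ f x)
    (i : Fin 2) : gradient f x i = partialDeriv i f x := by
  rw [partialDeriv, hf.lineDeriv_eq_fderiv]
  have h : inner ℝ (gradient f x) (EuclideanSpace.single i (1 : ℝ)) =
      fderiv ℝ f x (EuclideanSpace.single i 1) := by
    rw [gradient, toDual_symm_apply]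
  rw [← h, EuclideanSpace.inner_single_right]
  simp

lemma gradient_eq_lipGrad {f : Plane → ℝ} (hf : Differentiable ℝ f) :
    gradient f = lipGrad f := by
  funext x
  ext i
  rw [gradient_apply_eq_partialDeriv (hf x), lipGrad_apply]

lemma abs_partialDeriv_le {f : Plane → ℝ} {C : ℝ≥0} (hf : LipschitzWith C f) (i : Fin 2)
    (x : Plane) : |partialDeriv i f x| ≤ C := by
  have h := norm_lineDeriv_le_of_lipschitz ℝ hf (x₀ := x) (v := EuclideanSpace.single i (1 : ℝ))
  rwa [norm_single_one, mul_one, Real.norm_eq_abs] at h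

lemma norm_lipGrad_le {f : Plane → ℝ} {x : Plane} {B : ℝ} (h : ∀ i, |partialDeriv i f x| ≤ B) :
    ‖lipGrad f x‖ ≤ 2 * B := by
  have hB : 0 ≤ B := (abs_nonneg _).trans (h 0)
  rw [EuclideanSpace.norm_eq, Fin.sum_univ_two]
  refine Real.sqrt_le_iff.2 ⟨by positivity, ?_⟩
  have h0 := pow_le_pow_left₀ (abs_nonneg _) (h 0) 2
  have h1 := pow_le_pow_left₀ (abs_nonneg _) (h 1) 2
  simp only [lipGrad_apply, Real.norm_eq_abs]
  nlinarith [sq_nonneg B]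

lemma measurable_partialDeriv {f : Plane → ℝ} (hf : Continuous f) (i : Fin 2) :
    Measurable (partialDeriv i f) := measurable_lineDeriv hf

lemma measurable_lipGrad {f : Plane → ℝ} (hf : Continuous f) : Measurable (lipGrad f) :=
  (MeasurableEquiv.toLp 2 (Fin 2 → ℝ)).measurable.comp
    (measurable_pi_lambda _ fun i => measurable_partialDeriv hf i)

lemma lineDeriv_const_fun (c : ℝ) (x v : Plane) : lineDeriv ℝ (fun _ : Plane => c) x v = 0 := by
  rw [lineDeriv]
  exact deriv_const 0 c

lemma partialDeriv_congr {f g : Plane → ℝ} {x : Plane} (h : f =ᶠ[𝓝 x] g) (i : Fin 2) :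
    partialDeriv i f x = partialDeriv i g x := h.lineDeriv_eq

lemma partialDeriv_eq_zero_of_notMem_tsupport {f : Plane → ℝ} {x : Plane} (hx : x ∉ tsupport f)
    (i : Fin 2) : partialDeriv i f x = 0 := by
  have h : f =ᶠ[𝓝 x] fun _ => 0 := by
    filter_upwards [(isClosed_tsupport f).isOpen_compl.mem_nhds hx] with y hy
    exact image_eq_zero_of_notMem_tsupport hy
  rw [partialDeriv_congr h, partialDeriv, lineDeriv_const_fun]

lemma partialDeriv_comp_add (f : Plane → ℝ) (c x : Plane) (i : Fin 2) :
    partialDeriv i (fun y => f (y + c)) x = partialDeriv i f (x + c) := by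
  simp only [partialDeriv, lineDeriv]
  congr 1
  funext t
  rw [add_right_comm]

lemma partialDeriv_comp_sub_left (f : Plane → ℝ) (c x : Plane) (i : Fin 2) :
    partialDeriv i (fun y => f (c - y)) x = -partialDeriv i f (c - x) := by
  have h : ∀ v, lineDeriv ℝ (fun y => f (c - y)) x v = lineDeriv ℝ f (c - x) (-v) := by
    intro v
    simp only [lineDeriv]
    congr 1
    funext t
    congr 1
    module
  rw [partialDeriv, h, lineDeriv_neg, partialDeriv]

lemma ae_partialDeriv_mul {a b : Plane → ℝ} {A B : ℝ≥0} (ha : LipschitzWith A a)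
    (hb : LipschitzWith B b) (i : Fin 2) :
    ∀ᵐ x, partialDeriv i (fun y => a y * b y) x =
      partialDeriv i a x * b x + a x * partialDeriv i b x := by
  filter_upwards [ha.ae_lineDifferentiableAt (μ := volume) (EuclideanSpace.single i 1),
    hb.ae_lineDifferentiableAt (μ := volume) (EuclideanSpace.single i 1)] with x hax hbx
  have h := HasDerivAt.mul hax.hasLineDerivAt hbx.hasLineDerivAt
  have h' : HasLineDerivAt ℝ (fun y => a y * b y) _ x (EuclideanSpace.single i 1) := h
  rw [partialDeriv, h'.lineDeriv]
  simp [partialDeriv]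

/-- The first factor need not be bounded: only its values on the support of the second matter. -/
lemma exists_lipschitzWith_mul {a b : Plane → ℝ} {A B : ℝ≥0} (ha : LipschitzWith A a)
    (hb : LipschitzWith B b) (hc : HasCompactSupport b) :
    ∃ C : ℝ≥0, LipschitzWith C fun x => a x * b x := by
  obtain ⟨M, hM⟩ := hc.isCompact.exists_bound_of_continuousOn ha.continuous.continuousOn
  obtain ⟨D, hD⟩ := hc.exists_bound_of_continuous hb.continuous
  have hD0 : 0 ≤ D := (norm_nonneg _).trans (hD 0)
  have key : ∀ x y : Plane, x ∈ tsupport b →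
      |a x * b x - a y * b y| ≤ (max M 0 * B + D * A) * dist x y := by
    intro x y hx
    have h1 : |a x| ≤ max M 0 := (hM x hx).trans (le_max_left _ _)
    have h2 : |b y| ≤ D := hD y
    have h3 : |b x - b y| ≤ B * dist x y := hb.dist_le_mul x y
    have h4 : |a x - a y| ≤ A * dist x y := ha.dist_le_mul x y
    calc |a x * b x - a y * b y| = |a x * (b x - b y) + b y * (a x - a y)| := by
          congr 1; ring
      _ ≤ |a x| * |b x - b y| + |b y| * |a x - a y| := by
          rw [← abs_mul, ← abs_mul]; exact abs_add_le _ _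
      _ ≤ max M 0 * (B * dist x y) + D * (A * dist x y) := by gcongr
      _ = _ := by ring
  have hnn : 0 ≤ max M 0 * B + D * A := by positivity
  refine ⟨⟨_, hnn⟩, LipschitzWith.of_dist_le_mul fun x y => ?_⟩
  change |_ - _| ≤ (max M 0 * B + D * A) * dist x y
  by_cases hx : x ∈ tsupport b
  · exact key x y hx
  by_cases hy : y ∈ tsupport b
  · rw [abs_sub_comm, dist_comm]
    exact key y x hy
  · rw [image_eq_zero_of_notMem_tsupport hx, image_eq_zero_of_notMem_tsupport hy]
    simp only [mul_zero, sub_zero, abs_zero]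
    positivity

/-- A sequence of bump functions shrinking to the origin. -/
noncomputable def bump (n : ℕ) : ContDiffBump (0 : Plane) where
  rIn := 1 / (2 * ((n : ℝ) + 1))
  rOut := 1 / ((n : ℝ) + 1)
  rIn_pos := by positivity
  rIn_lt_rOut := by
    apply one_div_lt_one_div_of_lt <;> nlinarith [(Nat.cast_nonneg n : (0 : ℝ) ≤ n)]

/-- The standard mollifiers. -/
noncomputable def mollifier (n : ℕ) : Plane → ℝ := (bump n).normed volume

lemma tendsto_bump_rOut : Tendsto (fun n => (bump n).rOut) atTop (𝓝 0) :=
  tendsto_one_div_add_atTop_nhds_zero_nat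

lemma isTest_mollifier (n : ℕ) : IsTest (mollifier n) :=
  ⟨(bump n).contDiff_normed, (bump n).hasCompactSupport_normed⟩

lemma mollifier_eq_zero {n : ℕ} {x : Plane} (hx : (bump n).rOut ≤ ‖x‖) : mollifier n x = 0 := by
  have h : x ∉ Function.support (mollifier n) := by
    rw [mollifier, ContDiffBump.support_normed_eq]
    simpa using hx
  simpa using h

lemma IsTest.differentiable {φ : Plane → ℝ} (h : IsTest φ) : Differentiable ℝ φ :=
  h.1.differentiable (by simp)

lemma IsTest.exists_lipschitzWith {φ : Plane → ℝ} (h : IsTest φ) :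
    ∃ C : ℝ≥0, LipschitzWith C φ :=
  h.1.lipschitzWith_of_hasCompactSupport h.2 (by simp)

/-- Convolution of real functions on the plane. -/
noncomputable def conv (ρ g : Plane → ℝ) : Plane → ℝ :=
  convolution ρ g (ContinuousLinearMap.lsmul ℝ ℝ) volume

lemma conv_apply (ρ g : Plane → ℝ) (x : Plane) : conv ρ g x = ∫ t, ρ t * g (x - t) := rfl

lemma contDiff_conv {ρ g : Plane → ℝ} (hρ : IsTest ρ) (hg : LocallyIntegrable g) :
    ContDiff ℝ ∞ (conv ρ g) :=
  hρ.2.contDiff_convolution_left _ hρ.1 hg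

lemma partialDeriv_conv {ρ g : Plane → ℝ} (hρ : IsTest ρ) (hg : LocallyIntegrable g) (i : Fin 2)
    (x : Plane) : partialDeriv i (conv ρ g) x = conv (partialDeriv i ρ) g x := by
  have h1 := hρ.2.hasFDerivAt_convolution_left (ContinuousLinearMap.lsmul ℝ ℝ)
    (hρ.1.of_le (by simp)) hg (μ := volume) x
  have h2 : ConvolutionExists (fderiv ℝ ρ) g
      ((ContinuousLinearMap.lsmul ℝ ℝ).precompL Plane) volume :=
    HasCompactSupport.convolutionExists_left _ (hρ.2.fderiv (𝕜 := ℝ))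
      (hρ.1.continuous_fderiv (by simp)) hg
  have h3 : HasFDerivAt (conv ρ g) _ x := h1
  rw [partialDeriv, h3.differentiableAt.lineDeriv_eq_fderiv, h3.fderiv, convolution_def,
    ContinuousLinearMap.integral_apply (h2 x), conv_apply]
  refine integral_congr_ae (Eventually.of_forall fun t => ?_)
  simp only [ContinuousLinearMap.precompL_apply, partialDeriv,
    (hρ.differentiable t).lineDeriv_eq_fderiv]
  rfl

/-- For a Lipschitz function with compact support, the derivative may be moved to the other factor
of a convolution. -/
lemma partialDeriv_conv_lipschitz {ρ ψ : Plane → ℝ} {C : ℝ≥0} (hρ : IsTest ρ)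
    (hψ : LipschitzWith C ψ) (hc : HasCompactSupport ψ) (i : Fin 2) (x : Plane) :
    partialDeriv i (conv ρ ψ) x = conv ρ (partialDeriv i ψ) x := by
  obtain ⟨D, hD⟩ := hρ.exists_lipschitzWith
  have hflip : LipschitzWith C fun t => ψ (x - t) := LipschitzWith.of_dist_le_mul fun s t => by
    have h := hψ.dist_le_mul (x - s) (x - t)
    rwa [dist_sub_left] at h
  have hcflip : HasCompactSupport fun t => ψ (x - t) :=
    hc.comp_homeomorph (Homeomorph.subLeft x)
  rw [partialDeriv_conv hρ hψ.continuous.locallyIntegrable, conv_apply, conv_apply]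
  have h := hD.integral_lineDeriv_mul_eq (μ := volume) hflip hcflip (EuclideanSpace.single i 1)
  refine h.trans (integral_congr_ae (Eventually.of_forall fun t => ?_))
  have h2 := partialDeriv_comp_sub_left ψ x t i
  simp only [partialDeriv] at h2 ⊢
  rw [lineDeriv_neg, h2]
  ring

/-- Mollification of a compactly supported Lipschitz function. The derivatives converge only almost
everywhere, but boundedly, which is enough for dominated convergence. -/
lemma exists_test_approx {ψ : Plane → ℝ} {C : ℝ≥0} (hψ : LipschitzWith C ψ)
    (hc : HasCompactSupport ψ) {U : Set Plane} (hU : IsOpen U) (hsub : tsupport ψ ⊆ U) :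
    ∃ (K : Set Plane) (B : ℝ) (ψn : ℕ → Plane → ℝ), IsCompact K ∧ K ⊆ U ∧
      (∀ n, IsTest (ψn n) ∧ tsupport (ψn n) ⊆ K) ∧ (∀ n x, |ψn n x| ≤ B) ∧
      (∀ n i x, |partialDeriv i (ψn n) x| ≤ B) ∧
      (∀ x, Tendsto (fun n => ψn n x) atTop (𝓝 (ψ x))) ∧
      ∀ i, ∀ᵐ x, Tendsto (fun n => partialDeriv i (ψn n) x) atTop (𝓝 (partialDeriv i ψ x)) := by
  obtain ⟨δ, hδ, hδU⟩ := hc.isCompact.exists_cthickening_subset_open hU hsub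
  obtain ⟨M, hM⟩ := hc.exists_bound_of_continuous hψ.continuous
  have hr0 := tendsto_bump_rOut
  obtain ⟨N, hN⟩ := eventually_atTop.1 (hr0.eventually (gt_mem_nhds hδ))
  have hr1 : ∀ n, (bump n).rOut ≤ 1 := fun n => by
    change 1 / ((n : ℝ) + 1) ≤ 1
    rw [div_le_one (by positivity)]
    linarith [(Nat.cast_nonneg n : (0 : ℝ) ≤ n)]
  have hdist : ∀ n x, dist (conv (mollifier n) ψ x) (ψ x) ≤ C * (bump n).rOut := fun n x =>
    ContDiffBump.dist_normed_convolution_le hψ.continuous.aestronglyMeasurable fun y hy =>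
      (hψ.dist_le_mul y x).trans
        (mul_le_mul_of_nonneg_left (Metric.mem_ball.1 hy).le C.coe_nonneg)
  have hdist' : ∀ n i x, dist (conv (mollifier n) (partialDeriv i ψ) x) (partialDeriv i ψ x) ≤
      2 * C := fun n i x =>
    ContDiffBump.dist_normed_convolution_le
      (measurable_partialDeriv hψ.continuous i).aestronglyMeasurable fun y _ => by
        rw [Real.dist_eq]
        refine (abs_sub _ _).trans ?_
        linarith [abs_partialDeriv_le hψ i x, abs_partialDeriv_le hψ i y]
  refine ⟨Metric.cthickening δ (tsupport ψ), max (M + C) (3 * C),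
    fun n => conv (mollifier (n + N)) ψ, hc.isCompact.cthickening, hδU, fun n => ⟨⟨?_, ?_⟩, ?_⟩,
    fun n x => ?_, fun n i x => ?_, fun x => ?_, fun i => ?_⟩
  · exact contDiff_conv (isTest_mollifier _) hψ.continuous.locallyIntegrable
  · exact (isTest_mollifier _).2.convolution _ hc
  · refine closure_minimal (fun x hx => ?_) Metric.isClosed_cthickening
    obtain ⟨s, hs, t, ht, rfl⟩ := Set.mem_add.1 (support_convolution_subset _ hx)
    refine Metric.mem_cthickening_of_dist_le _ t _ _ (subset_tsupport _ ht) ?_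
    have hs' : ‖s‖ < (bump (n + N)).rOut := by
      by_contra hcon
      exact hs (mollifier_eq_zero (not_lt.1 hcon))
    simpa using (hs'.trans (hN _ (by omega))).le
  · refine le_trans ?_ (le_max_left _ _)
    have h1 := hdist (n + N) x
    rw [Real.dist_eq] at h1
    have h2 : |ψ x| ≤ M := hM x
    have h3 := abs_sub_abs_le_abs_sub (conv (mollifier (n + N)) ψ x) (ψ x)
    have h4 : C * (bump (n + N)).rOut ≤ C := mul_le_of_le_one_right C.coe_nonneg (hr1 _)
    linarith
  · refine le_trans ?_ (le_max_right _ _)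
    rw [partialDeriv_conv_lipschitz (isTest_mollifier _) hψ hc]
    have h1 := hdist' (n + N) i x
    rw [Real.dist_eq] at h1
    have h3 := abs_sub_abs_le_abs_sub (conv (mollifier (n + N)) (partialDeriv i ψ) x)
      (partialDeriv i ψ x)
    linarith [abs_partialDeriv_le hψ i x]
  · refine (tendsto_add_atTop_iff_nat (f := fun n => conv (mollifier n) ψ x) N).2 ?_
    refine tendsto_iff_dist_tendsto_zero.2
      (squeeze_zero (fun _ => dist_nonneg) (fun n => hdist n x) ?_)
    simpa using hr0.const_mul (C : ℝ)
  · have hli : LocallyIntegrable (partialDeriv i ψ) := hψ.locallyIntegrable_lineDeriv _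
    filter_upwards [ContDiffBump.ae_convolution_tendsto_right_of_locallyIntegrable (K := 2) hr0
      (Eventually.of_forall fun n => le_of_eq (by simp only [bump]; field_simp)) hli] with x hx
    refine Tendsto.congr (fun n =>
      (partialDeriv_conv_lipschitz (isTest_mollifier (n + N)) hψ hc i x).symm) ?_
    exact (tendsto_add_atTop_iff_nat
      (f := fun n => conv (mollifier n) (partialDeriv i ψ) x) N).2 hx

/-! ### Weak gradients -/

variable {Ω : Set Plane} {u : Plane → ℝ} {G : Plane → Plane}

lemma integrable_mul_of_support_subset {p f : Plane → ℝ} {K : Set Plane} {B : ℝ}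
    (hp : LocallyIntegrableOn p Ω) (hK : IsCompact K) (hKΩ : K ⊆ Ω) (hf : AEStronglyMeasurable f)
    (hB : ∀ x, |f x| ≤ B) (h0 : ∀ x, x ∉ K → f x = 0) : Integrable fun x => p x * f x := by
  have h1 : IntegrableOn p K := hp.integrableOn_compact_subset hKΩ hK
  have h2 : IntegrableOn (fun x => p x * f x) K :=
    h1.mul_bdd hf.restrict (Eventually.of_forall hB)
  refine (integrableOn_iff_integrable_of_support_subset fun x hx => ?_).1 h2
  by_contra hcon
  exact hx (by simp [h0 x hcon])

lemma locallyIntegrableOn_coord (hG : LocallyIntegrableOn G Ω) (i : Fin 2) :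
    LocallyIntegrableOn (fun x => G x i) Ω := by
  intro x hx
  obtain ⟨t, ht, hint⟩ := hG x hx
  exact ⟨t, ht, (EuclideanSpace.proj (𝕜 := ℝ) i).integrable_comp hint⟩

lemma tendsto_integral_mul_of_support_subset {p f : Plane → ℝ} {fn : ℕ → Plane → ℝ}
    {K : Set Plane} {B : ℝ} (hp : LocallyIntegrableOn p Ω) (hK : IsCompact K)
    (hKΩ : K ⊆ Ω) (hfn : ∀ n, AEStronglyMeasurable (fn n)) (hB : ∀ n x, |fn n x| ≤ B)
    (h0 : ∀ n x, x ∉ K → fn n x = 0)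
    (hlim : ∀ᵐ x, Tendsto (fun n => fn n x) atTop (𝓝 (f x))) :
    Tendsto (fun n => ∫ x in Ω, p x * fn n x) atTop (𝓝 (∫ x in Ω, p x * f x)) := by
  have h1 : IntegrableOn p K := hp.integrableOn_compact_subset hKΩ hK
  have hB0 : 0 ≤ B := (abs_nonneg _).trans (hB 0 0)
  refine tendsto_integral_of_dominated_convergence (K.indicator fun x => ‖p x‖ * B)
    (fun n => ?_) ?_ (fun n => Eventually.of_forall fun x => ?_) ?_
  · exact hp.aestronglyMeasurable.mul (hfn n).restrict
  · exact ((integrable_indicator_iff hK.measurableSet).2 (h1.norm.mul_const B)).integrableOn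
  · by_cases hx : x ∈ K
    · rw [Set.indicator_of_mem hx, norm_mul]
      exact mul_le_mul_of_nonneg_left (hB n x) (norm_nonneg _)
    · simp [h0 n x hx, Set.indicator_of_notMem hx]
  · filter_upwards [ae_restrict_of_ae hlim] with x hx
    exact hx.const_mul _

/-- Weak gradients may be tested with compactly supported Lipschitz functions. -/
lemma IsWeakGrad.integral_eq_of_lipschitz (hΩ : IsOpen Ω) (hG : IsWeakGrad Ω u G) {ψ : Plane → ℝ}
    {C : ℝ≥0} (hψ : LipschitzWith C ψ) (hc : HasCompactSupport ψ) (hsub : tsupport ψ ⊆ Ω)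
    (i : Fin 2) :
    ∫ x in Ω, u x * partialDeriv i ψ x = - ∫ x in Ω, G x i * ψ x := by
  obtain ⟨K, B, ψn, hK, hKU, htest, hB, hB', hlim, hlim'⟩ := exists_test_approx hψ hc hΩ hsub
  have h1 := tendsto_integral_mul_of_support_subset (fn := fun n => partialDeriv i (ψn n))
    hG.locallyIntegrable hK hKU
    (fun n => (measurable_partialDeriv (htest n).1.1.continuous i).aestronglyMeasurable)
    (fun n x => hB' n i x)
    (fun n x hx => partialDeriv_eq_zero_of_notMem_tsupport (fun h => hx ((htest n).2 h)) i)
    (hlim' i)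
  have h2 := tendsto_integral_mul_of_support_subset (fn := ψn)
    (locallyIntegrableOn_coord hG.locallyIntegrable_grad i) hK hKU
    (fun n => (htest n).1.1.continuous.aestronglyMeasurable) hB
    (fun n x hx => image_eq_zero_of_notMem_tsupport fun h => hx ((htest n).2 h))
    (Eventually.of_forall hlim)
  refine tendsto_nhds_unique h1 (h2.neg.congr fun n => ?_)
  rw [← hG.integral_eq (ψn n) (htest n).1 ((htest n).2.trans hKU) i]
  simp only [gradient_apply_eq_partialDeriv ((htest n).1.differentiable _)]

/-- Product rule for a Lipschitz function and a function with a weak gradient. -/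
lemma IsWeakGrad.lipschitz_mul (hΩ : IsOpen Ω) (hG : IsWeakGrad Ω u G) {a : Plane → ℝ} {A : ℝ≥0}
    (ha : LipschitzWith A a) :
    IsWeakGrad Ω (fun x => a x * u x) (fun x => u x • lipGrad a x + a x • G x) where
  locallyIntegrable :=
    LocallyIntegrableOn.continuousOn_mul hG.locallyIntegrable ha.continuous.continuousOn
      hΩ.isLocallyClosed
  locallyIntegrable_grad := by
    refine LocallyIntegrableOn.add ?_ ?_
    · have hb : ∀ x, ‖lipGrad a x‖ ≤ 2 * A := fun x =>
        norm_lipGrad_le fun i => abs_partialDeriv_le ha i x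
      intro x hx
      obtain ⟨t, ht, hint⟩ := hG.locallyIntegrable x hx
      exact ⟨t, ht, Integrable.smul_bdd hint (2 * (A : ℝ))
        (measurable_lipGrad ha.continuous).aestronglyMeasurable (Eventually.of_forall hb)⟩
    · exact LocallyIntegrableOn.continuousOn_smul hΩ.isLocallyClosed hG.locallyIntegrable_grad
        ha.continuous.continuousOn
  integral_eq := by
    intro φ hφ hsub i
    obtain ⟨D, hD⟩ := hφ.exists_lipschitzWith
    obtain ⟨C, hC⟩ := exists_lipschitzWith_mul ha hD hφ.2
    have hcs : HasCompactSupport fun x => a x * φ x := hφ.2.mul_left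
    have hts : tsupport (fun x => a x * φ x) ⊆ tsupport φ := tsupport_mul_subset_right
    have h1 := hG.integral_eq_of_lipschitz hΩ hC hcs (hts.trans hsub) i
    obtain ⟨M, hM⟩ := hcs.exists_bound_of_continuous hC.continuous
    obtain ⟨M', hM'⟩ := hφ.2.exists_bound_of_continuous hφ.1.continuous
    have hM'0 : 0 ≤ M' := (norm_nonneg _).trans (hM' 0)
    have hi1 : Integrable fun x => u x * partialDeriv i (fun x => a x * φ x) x :=
      integrable_mul_of_support_subset hG.locallyIntegrable hφ.2.isCompact hsub
        (measurable_partialDeriv hC.continuous i).aestronglyMeasurable (abs_partialDeriv_le hC i)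
        fun x hx => partialDeriv_eq_zero_of_notMem_tsupport (fun h => hx (hts h)) i
    have hi2 : Integrable fun x => u x * (partialDeriv i a x * φ x) :=
      integrable_mul_of_support_subset (B := A * M') hG.locallyIntegrable hφ.2.isCompact hsub
        ((measurable_partialDeriv ha.continuous i).mul hφ.1.continuous.measurable
          ).aestronglyMeasurable
        (fun x => by
          rw [abs_mul]
          exact mul_le_mul (abs_partialDeriv_le ha i x) (hM' x) (abs_nonneg _) A.coe_nonneg)
        fun x hx => by rw [image_eq_zero_of_notMem_tsupport hx, mul_zero]
    have hi3 : Integrable fun x => G x i * (a x * φ x) :=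
      integrable_mul_of_support_subset (B := M)
        (locallyIntegrableOn_coord hG.locallyIntegrable_grad i) hφ.2.isCompact hsub
        hC.continuous.aestronglyMeasurable hM
        fun x hx => by rw [image_eq_zero_of_notMem_tsupport hx, mul_zero]
    calc ∫ x in Ω, a x * u x * gradient φ x i
        = ∫ x in Ω, (u x * partialDeriv i (fun x => a x * φ x) x
            - u x * (partialDeriv i a x * φ x)) := by
          refine integral_congr_ae (ae_restrict_of_ae ?_)
          filter_upwards [ae_partialDeriv_mul ha hD i] with x hx
          rw [hx, gradient_apply_eq_partialDeriv (hφ.differentiable x)]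
          ring
      _ = - ((∫ x in Ω, G x i * (a x * φ x)) + ∫ x in Ω, u x * (partialDeriv i a x * φ x)) := by
          rw [integral_sub hi1.integrableOn hi2.integrableOn, h1]
          ring
      _ = - ∫ x in Ω, (u x • lipGrad a x + a x • G x) i * φ x := by
          rw [← integral_add hi3.integrableOn hi2.integrableOn]
          congr 1
          refine integral_congr_ae (Eventually.of_forall fun x => ?_)
          simp only [PiLp.add_apply, PiLp.smul_apply, smul_eq_mul, lipGrad_apply]
          ring

lemma isWeakGrad_one : IsWeakGrad Ω (fun _ => 1) (fun _ => 0) where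
  locallyIntegrable := (continuous_const.locallyIntegrable).locallyIntegrableOn _
  locallyIntegrable_grad := (continuous_const.locallyIntegrable).locallyIntegrableOn _
  integral_eq := by
    intro φ hφ hsub i
    obtain ⟨D, hD⟩ := hφ.exists_lipschitzWith
    have h := (LipschitzWith.const (1 : ℝ) : LipschitzWith 0 fun _ : Plane => (1 : ℝ)
      ).integral_lineDeriv_mul_eq (μ := volume) hD hφ.2 (-EuclideanSpace.single i 1)
    simp only [lineDeriv_const_fun, zero_mul, integral_zero, neg_neg, mul_one] at h
    simp only [PiLp.zero_apply, zero_mul, integral_zero, neg_zero, one_mul,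
      gradient_apply_eq_partialDeriv (hφ.differentiable _)]
    rw [setIntegral_eq_integral_of_forall_compl_eq_zero]
    · exact h.symm
    · exact fun x hx => partialDeriv_eq_zero_of_notMem_tsupport (fun hx' => hx (hsub hx')) i

lemma isWeakGrad_of_lipschitz (hΩ : IsOpen Ω) {a : Plane → ℝ} {A : ℝ≥0} (ha : LipschitzWith A a) :
    IsWeakGrad Ω a (lipGrad a) := by
  simpa using (isWeakGrad_one (Ω := Ω)).lipschitz_mul hΩ ha

lemma IsWeakGrad.integrable_mul_test {φ : Plane → ℝ} (hG : IsWeakGrad Ω u G) (hφ : IsTest φ)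
    (hsub : tsupport φ ⊆ Ω) (i : Fin 2) :
    (Integrable fun x => u x * gradient φ x i) ∧ Integrable fun x => G x i * φ x := by
  obtain ⟨D, hD⟩ := hφ.exists_lipschitzWith
  obtain ⟨M, hM⟩ := hφ.2.exists_bound_of_continuous hφ.1.continuous
  simp only [gradient_apply_eq_partialDeriv (hφ.differentiable _)]
  exact ⟨integrable_mul_of_support_subset hG.locallyIntegrable hφ.2.isCompact hsub
      (measurable_partialDeriv hD.continuous i).aestronglyMeasurable (abs_partialDeriv_le hD i)
      fun x hx => partialDeriv_eq_zero_of_notMem_tsupport hx i,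
    integrable_mul_of_support_subset (locallyIntegrableOn_coord hG.locallyIntegrable_grad i)
      hφ.2.isCompact hsub hφ.1.continuous.aestronglyMeasurable hM
      fun x hx => image_eq_zero_of_notMem_tsupport hx⟩

lemma IsWeakGrad.add {v : Plane → ℝ} {G' : Plane → Plane} (hG : IsWeakGrad Ω u G)
    (hG' : IsWeakGrad Ω v G') : IsWeakGrad Ω (fun x => u x + v x) (fun x => G x + G' x) where
  locallyIntegrable := hG.locallyIntegrable.add hG'.locallyIntegrable
  locallyIntegrable_grad := hG.locallyIntegrable_grad.add hG'.locallyIntegrable_grad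
  integral_eq := by
    intro φ hφ hsub i
    obtain ⟨h1, h2⟩ := hG.integrable_mul_test hφ hsub i
    obtain ⟨h3, h4⟩ := hG'.integrable_mul_test hφ hsub i
    simp only [add_mul, PiLp.add_apply]
    rw [integral_add h1.integrableOn h3.integrableOn, integral_add h2.integrableOn h4.integrableOn,
      hG.integral_eq φ hφ hsub i, hG'.integral_eq φ hφ hsub i]
    ring

lemma IsWeakGrad.sub {v : Plane → ℝ} {G' : Plane → Plane} (hG : IsWeakGrad Ω u G)
    (hG' : IsWeakGrad Ω v G') : IsWeakGrad Ω (fun x => u x - v x) (fun x => G x - G' x) where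
  locallyIntegrable := hG.locallyIntegrable.sub hG'.locallyIntegrable
  locallyIntegrable_grad := hG.locallyIntegrable_grad.sub hG'.locallyIntegrable_grad
  integral_eq := by
    intro φ hφ hsub i
    obtain ⟨h1, h2⟩ := hG.integrable_mul_test hφ hsub i
    obtain ⟨h3, h4⟩ := hG'.integrable_mul_test hφ hsub i
    simp only [sub_mul, PiLp.sub_apply]
    rw [integral_sub h1.integrableOn h3.integrableOn, integral_sub h2.integrableOn h4.integrableOn,
      hG.integral_eq φ hφ hsub i, hG'.integral_eq φ hφ hsub i]
    ring

lemma IsWeakGrad.ae_eq {G' : Plane → Plane} (hΩ : IsOpen Ω) (hG : IsWeakGrad Ω u G)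
    (hG' : IsWeakGrad Ω u G') : ∀ᵐ x ∂volume.restrict Ω, G x = G' x := by
  have hcoord : ∀ i : Fin 2, ∀ᵐ x ∂volume.restrict Ω, G x i = G' x i := by
    intro i
    rw [ae_restrict_iff' hΩ.measurableSet]
    have h := hΩ.ae_eq_zero_of_integral_contDiff_smul_eq_zero (μ := volume)
      (f := fun x => G x i - G' x i)
      ((locallyIntegrableOn_coord hG.locallyIntegrable_grad i).sub
        (locallyIntegrableOn_coord hG'.locallyIntegrable_grad i)) (fun φ hφ hc hsub => ?_)
    · filter_upwards [h] with x hx hxΩ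
      linarith [hx hxΩ]
    · have h2 := (hG.integrable_mul_test ⟨hφ, hc⟩ hsub i).2
      have h4 := (hG'.integrable_mul_test ⟨hφ, hc⟩ hsub i).2
      have e1 : ∀ f : Plane → ℝ, ∫ x in Ω, f x * φ x = ∫ x, f x * φ x := fun f =>
        setIntegral_eq_integral_of_forall_compl_eq_zero fun x hx => by
          rw [image_eq_zero_of_notMem_tsupport fun h => hx (hsub h), mul_zero]
      have h5 := hG.integral_eq φ ⟨hφ, hc⟩ hsub i
      rw [hG'.integral_eq φ ⟨hφ, hc⟩ hsub i, e1 fun x => G' x i, e1 fun x => G x i] at h5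
      have h6 : ∀ x, φ x • (G x i - G' x i) = G x i * φ x - G' x i * φ x := fun x => by
        rw [smul_eq_mul]; ring
      simp only [h6]
      rw [integral_sub h2 h4]
      linarith
  filter_upwards [hcoord 0, hcoord 1] with x h0 h1
  ext i
  fin_cases i
  · exact h0
  · exact h1

/-! ### Density of smooth functions in the space of test functions -/

lemma continuous_integral_mul_translate {f g : Plane → ℝ} (hf : MemLp f 2 volume)
    (hg : MemLp g 2 volume) : Continuous fun s : Plane => ∫ x, f x * g (x + s) := by
  have h : (fun s : Plane => ∫ x, f x * g (x + s)) =
      fun s => inner ℝ (hf.toLp f) (DomAddAct.mk s +ᵥ hg.toLp g) := by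
    funext s
    rw [DomAddAct.mk_vadd_toLp, L2.inner_def]
    refine integral_congr_ae ?_
    filter_upwards [hf.coeFn_toLp, (hg.comp_measurePreserving
      (measurePreserving_vadd s (volume : Measure Plane))).coeFn_toLp] with x hx hx'
    have hx'' : ((MemLp.toLp (fun x => g (s +ᵥ x)) (hg.comp_measurePreserving
      (measurePreserving_vadd s (volume : Measure Plane))) : Lp ℝ 2 volume) : Plane → ℝ) x =
        g (s + x) := hx'
    rw [hx, hx'', add_comm s x]
    simp [mul_comm]
  rw [h]
  have : Fact ((2 : ℝ≥0∞) ≠ ⊤) := ⟨by simp⟩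
  exact continuous_const.inner
    ((DomAddAct.continuous_mk).vadd continuous_const)

lemma integral_mul_conv_translate {f g ρ : Plane → ℝ} (hf : MemLp f 2 volume)
    (hg : MemLp g 2 volume) (hρ : Continuous ρ) (hc : HasCompactSupport ρ) (c : Plane) :
    ∫ x, f x * conv ρ g (x + c) = conv ρ (fun s => ∫ x, f x * g (x + s)) c := by
  have hgc : MemLp (fun x => g (x + c)) 2 volume :=
    hg.comp_measurePreserving (measurePreserving_add_right volume c)
  have hshift : ∀ x t : Plane, x + c - t = x - t + c := fun x t => by abel
  have hmeas : AEStronglyMeasurable (fun p : Plane × Plane => f p.1 * (ρ p.2 * g (p.1 + c - p.2)))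
      ((volume : Measure Plane).prod volume) := by
    have h := AEStronglyMeasurable.convolution_integrand (μ := (volume : Measure Plane))
      (ν := (volume : Measure Plane)) (ContinuousLinearMap.lsmul ℝ ℝ) hρ.aestronglyMeasurable
      hgc.aestronglyMeasurable
    simp only [ContinuousLinearMap.lsmul_apply, smul_eq_mul] at h
    simp only [hshift]
    exact hf.aestronglyMeasurable.comp_fst.mul h
  have hgt : ∀ t : Plane, MemLp (fun x => g (x + c - t)) 2 volume := fun t => by
    simp only [add_sub_assoc]
    exact hg.comp_measurePreserving (measurePreserving_add_right volume (c - t))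
  have hint : Integrable (fun p : Plane × Plane => f p.1 * (ρ p.2 * g (p.1 + c - p.2)))
      ((volume : Measure Plane).prod volume) := by
    rw [integrable_prod_iff' hmeas]
    refine ⟨Eventually.of_forall fun t => ?_, ?_⟩
    · exact hf.integrable_mul ((hgt t).const_mul (ρ t))
    · have h1 : (fun t : Plane => ∫ x, ‖f x * (ρ t * g (x + c - t))‖) =
          fun t => ‖ρ t‖ * ∫ x, ‖f x‖ * ‖g (x + (c - t))‖ := by
        funext t
        rw [← integral_const_mul]
        refine integral_congr_ae (Eventually.of_forall fun x => ?_)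
        simp only [norm_mul, add_sub_assoc]
        ring
      rw [h1]
      have h2 := (continuous_integral_mul_translate hf.norm hg.norm).comp
        (continuous_const.sub continuous_id : Continuous fun t : Plane => c - t)
      exact (hρ.norm.mul h2).integrable_of_hasCompactSupport hc.norm.mul_right
  calc ∫ x, f x * conv ρ g (x + c) = ∫ x, ∫ t, f x * (ρ t * g (x + c - t)) := by
        refine integral_congr_ae (Eventually.of_forall fun x => ?_)
        simp only [conv_apply]
        rw [integral_const_mul]
    _ = ∫ t, ∫ x, f x * (ρ t * g (x + c - t)) := integral_integral_swap hint
    _ = conv ρ (fun s => ∫ x, f x * g (x + s)) c := by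
        rw [conv_apply]
        refine integral_congr_ae (Eventually.of_forall fun t => ?_)
        simp only
        rw [← integral_const_mul]
        refine integral_congr_ae (Eventually.of_forall fun x => ?_)
        simp only [add_sub_assoc]
        ring

/-- At points of the square, the distance to the three lines that carry the sides of the square other
than the bottom one; it is nonpositive on the Dirichlet part of the boundary. -/
noncomputable def sideDist (L : ℝ) (x : Plane) : ℝ := min (min (x 0) (L - x 0)) (L - x 1)

lemma lipschitzWith_sideDist (L : ℝ) : LipschitzWith 1 (sideDist L) := by
  have h : ∀ i : Fin 2, LipschitzWith 1 fun x : Plane => L - x i := fun i =>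
    LipschitzWith.of_dist_le_mul fun x y => by
      have h := (lipschitzWith_coord i).dist_le_mul x y
      rwa [← dist_sub_left L] at h
  have h1 := ((lipschitzWith_coord 0).min (h 0)).min (h 1)
  rw [max_self, max_self] at h1
  exact h1

lemma isOpen_square (L : ℝ) : IsOpen (square L) :=
  ((isOpen_lt continuous_const (continuous_coord 0)).inter
    (isOpen_lt (continuous_coord 0) continuous_const)).inter
    ((isOpen_lt continuous_const (continuous_coord 1)).inter
    (isOpen_lt (continuous_coord 1) continuous_const))

lemma mem_square_iff {L : ℝ} {x : Plane} : x ∈ square L ↔ 0 < sideDist L x ∧ 0 < x 1 := by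
  simp only [square, Set.mem_ofPred_eq, sideDist, lt_min_iff, sub_pos]
  tauto

lemma sideDist_nonpos_of_mem_dirichletPart {L : ℝ} {x : Plane} (hx : x ∈ dirichletPart L) :
    sideDist L x ≤ 0 := by
  obtain ⟨hfr, hnb⟩ := hx
  rw [(isOpen_square L).frontier_eq] at hfr
  have hcl : 0 ≤ x 1 := by
    have : closure (square L) ⊆ {x : Plane | 0 ≤ x 1} :=
      closure_minimal (fun y hy => show 0 ≤ y 1 from (mem_square_iff.1 hy).2.le)
        (isClosed_le continuous_const (continuous_coord 1))
    exact this hfr.1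
  have h1 : x 1 ≠ 0 := fun h => hnb ⟨(isOpen_square L).frontier_eq ▸ hfr, h⟩
  by_contra hcon
  exact hfr.2 (mem_square_iff.2 ⟨not_le.1 hcon, lt_of_le_of_ne hcl h1.symm⟩)

/-- The function `s ↦ min (max (s - 1) 0) 1`, a ramp from `0` to `1` on `[1, 2]`. -/
noncomputable def ramp (s : ℝ) : ℝ := min (max (s - 1) 0) 1

lemma lipschitzWith_ramp : LipschitzWith 1 ramp := by
  have h : LipschitzWith 1 fun s : ℝ => s - 1 := LipschitzWith.of_dist_le_mul fun s t => by simp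
  exact (h.max_const 0).min_const 1

lemma ramp_nonneg (s : ℝ) : 0 ≤ ramp s := le_min (le_max_right _ _) zero_le_one

lemma ramp_le_one (s : ℝ) : ramp s ≤ 1 := min_le_right _ _

lemma ramp_of_le {s : ℝ} (hs : s ≤ 1) : ramp s = 0 := by
  rw [ramp, max_eq_right (by linarith), min_eq_left zero_le_one]

lemma ramp_of_ge {s : ℝ} (hs : 2 ≤ s) : ramp s = 1 := by
  rw [ramp, max_eq_left (by linarith), min_eq_right (by linarith)]

/-- The cutoff function which vanishes at distance at most `ε` from the lateral and top sides of the
square, and equals one at distance at least `2ε`. -/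
noncomputable def cutoff (L ε : ℝ) (x : Plane) : ℝ := ramp (ε⁻¹ * sideDist L x)

lemma lipschitzWith_cutoff (L ε : ℝ) (hε : 0 < ε) :
    LipschitzWith (Real.toNNReal ε⁻¹) (cutoff L ε) := by
  refine LipschitzWith.of_dist_le_mul fun x y => ?_
  rw [Real.coe_toNNReal _ (by positivity)]
  refine (lipschitzWith_ramp.dist_le_mul _ _).trans ?_
  have h := (lipschitzWith_sideDist L).dist_le_mul x y
  rw [NNReal.coe_one, one_mul, Real.dist_eq] at h ⊢
  rw [← mul_sub, abs_mul, abs_of_pos (by positivity : 0 < ε⁻¹)]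
  gcongr

lemma cutoff_eq_zero {L ε : ℝ} (hε : 0 < ε) {x : Plane} (hx : sideDist L x ≤ ε) :
    cutoff L ε x = 0 := by
  refine ramp_of_le ?_
  rw [inv_mul_le_iff₀ hε]; linarith

lemma cutoff_eq_one {L ε : ℝ} (hε : 0 < ε) {x : Plane} (hx : 2 * ε ≤ sideDist L x) :
    cutoff L ε x = 1 := by
  refine ramp_of_ge ?_
  rw [le_inv_mul_iff₀ hε]; linarith

lemma cutoff_nonneg (L ε : ℝ) (x : Plane) : 0 ≤ cutoff L ε x := ramp_nonneg _

lemma cutoff_le_one (L ε : ℝ) (x : Plane) : cutoff L ε x ≤ 1 := ramp_le_one _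

lemma lipGrad_cutoff_eq_zero_of_lt {L ε : ℝ} (hε : 0 < ε) {x : Plane} (hx : sideDist L x < ε) :
    lipGrad (cutoff L ε) x = 0 := by
  ext i
  have h : cutoff L ε =ᶠ[𝓝 x] fun _ => 0 := by
    filter_upwards [(isOpen_lt (lipschitzWith_sideDist L).continuous
      continuous_const).mem_nhds hx] with y hy using cutoff_eq_zero hε (le_of_lt hy)
  rw [lipGrad_apply, partialDeriv_congr h, partialDeriv, lineDeriv_const_fun]
  rfl

lemma lipGrad_cutoff_eq_zero_of_gt {L ε : ℝ} (hε : 0 < ε) {x : Plane}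
    (hx : 2 * ε < sideDist L x) : lipGrad (cutoff L ε) x = 0 := by
  ext i
  have h : cutoff L ε =ᶠ[𝓝 x] fun _ => 1 := by
    filter_upwards [(isOpen_lt continuous_const
      (lipschitzWith_sideDist L).continuous).mem_nhds hx] with y hy
      using cutoff_eq_one hε (le_of_lt hy)
  rw [lipGrad_apply, partialDeriv_congr h, partialDeriv, lineDeriv_const_fun]
  rfl

variable {L δ : ℝ} {F W : Plane → Plane} {V : Plane → ℝ}

/-- A function on the square which vanishes near the lateral and top sides has the same weak
gradient, after extension by zero, in the whole upper half-plane. -/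
lemma IsWeakGrad.integral_eq_of_vanishing (hδ : 0 < δ) (hVW : IsWeakGrad (square L) V W)
    (hV0 : ∀ x ∈ square L, sideDist L x < δ → V x = 0)
    (hW0 : ∀ x ∈ square L, sideDist L x < δ → W x = 0) {φ : Plane → ℝ} (hφ : IsTest φ)
    (hsub : tsupport φ ⊆ {x | 0 < x 1}) (i : Fin 2) :
    ∫ x in square L, V x * partialDeriv i φ x = - ∫ x in square L, W x i * φ x := by
  set χ := cutoff L (δ / 4) with hχ
  have hδ4 : 0 < δ / 4 := by positivity
  have hχL := lipschitzWith_cutoff L (δ / 4) hδ4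
  obtain ⟨D, hD⟩ := hφ.exists_lipschitzWith
  obtain ⟨C, hC⟩ := exists_lipschitzWith_mul hχL hD hφ.2
  have hcs : HasCompactSupport fun x => χ x * φ x := hφ.2.mul_left
  have hts : tsupport (fun x => χ x * φ x) ⊆ square L := by
    intro x hx
    refine mem_square_iff.2 ⟨?_, hsub (tsupport_mul_subset_right hx)⟩
    have h1 : x ∈ {x | δ / 4 ≤ sideDist L x} := by
      refine closure_minimal (fun y hy => ?_)
        (isClosed_le continuous_const (lipschitzWith_sideDist L).continuous)
        (tsupport_mul_subset_left hx)
      by_contra hcon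
      exact hy (cutoff_eq_zero hδ4 (le_of_lt (not_le.1 hcon)))
    exact hδ4.trans_le h1
  have h := hVW.integral_eq_of_lipschitz (isOpen_square L) hC hcs hts i
  -- where `V` does not vanish, `χ` is one in a neighbourhood
  have e1 : ∫ x in square L, V x * partialDeriv i (fun x => χ x * φ x) x =
      ∫ x in square L, V x * partialDeriv i φ x := by
    refine setIntegral_congr_fun (isOpen_square L).measurableSet fun x hx => ?_
    by_cases hd : sideDist L x < δ
    · simp only [hV0 x hx hd, zero_mul]
    · have h2 : δ / 2 < sideDist L x := by linarith [not_lt.1 hd]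
      have h3 : (fun x => χ x * φ x) =ᶠ[𝓝 x] φ := by
        filter_upwards [(isOpen_lt continuous_const
          (lipschitzWith_sideDist L).continuous).mem_nhds h2] with y hy
        have hy' : δ / 2 < sideDist L y := hy
        rw [hχ, cutoff_eq_one hδ4 (by linarith), one_mul]
      simp only [partialDeriv_congr h3]
  have e2 : ∫ x in square L, W x i * (χ x * φ x) = ∫ x in square L, W x i * φ x := by
    refine setIntegral_congr_fun (isOpen_square L).measurableSet fun x hx => ?_
    by_cases hd : sideDist L x < δ
    · simp [hW0 x hx hd]
    · simp only [hχ, cutoff_eq_one hδ4 (show 2 * (δ / 4) ≤ sideDist L x by linarith [not_lt.1 hd]),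
        one_mul]
  rw [← e1, h, e2]

lemma memLp_coord {Ω : Set Plane} (hW : MemLp W 2 (volume.restrict Ω)) (i : Fin 2) :
    MemLp (fun x => W x i) 2 (volume.restrict Ω) :=
  (EuclideanSpace.proj (𝕜 := ℝ) i).comp_memLp' hW

lemma memLp_indicator_square {f : Plane → ℝ} (hf : MemLp f 2 (volume.restrict (square L))) :
    MemLp ((square L).indicator f) 2 volume :=
  (memLp_indicator_iff_restrict (isOpen_square L).measurableSet).2 hf

lemma inner_eq_sum (x y : Plane) : inner ℝ x y = ∑ i, x i * y i := by
  rw [PiLp.inner_apply]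
  exact Finset.sum_congr rfl fun i _ => by simp [mul_comm]

lemma IsTest.memLp_gradient {φ : Plane → ℝ} (hφ : IsTest φ) (Ω : Set Plane) :
    MemLp (gradient φ) 2 (volume.restrict Ω) := by
  have h1 : Continuous (gradient φ) :=
    (toDual ℝ Plane).symm.continuous.comp (hφ.1.continuous_fderiv (by simp))
  have h2 : HasCompactSupport (gradient φ) :=
    (hφ.2.fderiv (𝕜 := ℝ)).comp_left (g := (toDual ℝ Plane).symm) (map_zero _)
  exact (h1.memLp_of_hasCompactSupport h2).restrict Ω

lemma IsTestV.memV {φ : Plane → ℝ} (hφ : IsTestV L φ) : MemV L φ (gradient φ) := by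
  obtain ⟨D, hD⟩ := hφ.1.exists_lipschitzWith
  refine ⟨⟨(hφ.1.1.continuous.memLp_of_hasCompactSupport hφ.1.2).restrict _,
    hφ.1.memLp_gradient _, ?_⟩, fun _ => φ, fun _ => hφ, by simp, by simp⟩
  rw [gradient_eq_lipGrad hφ.1.differentiable]
  exact isWeakGrad_of_lipschitz (isOpen_square L) hD

/-- A function with weak gradient in `L²` which vanishes near the lateral and top sides is an
admissible test function. Its extension by zero is translated upwards and mollified at a smaller
scale: at points of the square this only involves values of the extension in the upper
half-plane. -/
theorem integral_inner_eq_zero_of_vanishing (hδ : 0 < δ)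
    (hF : MemLp F 2 (volume.restrict (square L)))
    (hweak : ∀ φ, IsTestV L φ → ∫ x in square L, inner ℝ (F x) (gradient φ x) = 0)
    (hV : MemLp V 2 (volume.restrict (square L))) (hW : MemLp W 2 (volume.restrict (square L)))
    (hVW : IsWeakGrad (square L) V W)
    (hV0 : ∀ x ∈ square L, sideDist L x < δ → V x = 0)
    (hW0 : ∀ x ∈ square L, sideDist L x < δ → W x = 0) :
    ∫ x in square L, inner ℝ (F x) (W x) = 0 := by
  have hSm := (isOpen_square L).measurableSet
  set S := square L with hS
  set V' : Plane → ℝ := S.indicator V with hV'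
  set W' : Fin 2 → Plane → ℝ := fun i => S.indicator fun x => W x i with hW'
  set F' : Fin 2 → Plane → ℝ := fun i => S.indicator fun x => F x i with hF'
  have hV'L : MemLp V' 2 volume := memLp_indicator_square hV
  have hW'L : ∀ i, MemLp (W' i) 2 volume := fun i => memLp_indicator_square (memLp_coord hW i)
  have hF'L : ∀ i, MemLp (F' i) 2 volume := fun i => memLp_indicator_square (memLp_coord hF i)
  have hV'li : LocallyIntegrable V' := hV'L.locallyIntegrable one_le_two
  set r : ℕ → ℝ := fun n => (bump n).rOut with hr
  have hr0 : Tendsto r atTop (𝓝 0) := tendsto_bump_rOut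
  have hrpos : ∀ n, 0 < r n := fun n => (bump n).rOut_pos
  set c : ℕ → Plane := fun n => (2 * r n) • !₂[0, 1] with hc
  have hcn : ∀ n, ‖c n‖ = 2 * r n := fun n => by
    have h1 : ‖(!₂[0, 1] : Plane)‖ = 1 := by simp [EuclideanSpace.norm_eq]
    rw [hc, norm_smul, h1, mul_one, Real.norm_of_nonneg (by linarith [hrpos n])]
  have hc1 : ∀ n, c n 1 = 2 * r n := fun n => by simp [hc]
  set φ : ℕ → Plane → ℝ := fun n x => conv (mollifier n) V' (x + c n) with hφ
  set A : Fin 2 → Plane → ℝ := fun i s => ∫ x, F' i x * W' i (x + s) with hA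
  have hAc : ∀ i, Continuous (A i) := fun i => continuous_integral_mul_translate (hF'L i) (hW'L i)
  -- the approximations are supported away from the lateral and top sides
  have hsupp : ∀ n, 3 * r n < δ / 2 → ∀ x, φ n x ≠ 0 →
      δ / 2 ≤ sideDist L x ∧ ∃ y ∈ S, ‖x - y‖ ≤ 3 * r n := by
    intro n hn x hx
    obtain ⟨s, hs, t, ht, hst⟩ := Set.mem_add.1 (support_convolution_subset _ hx)
    have htS : t ∈ S := by
      by_contra hcon
      exact ht (Set.indicator_of_notMem hcon _)
    have hsr : ‖s‖ < r n := by
      by_contra hcon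
      exact hs (mollifier_eq_zero (not_lt.1 hcon))
    have htd : δ ≤ sideDist L t := by
      by_contra hcon
      refine ht ?_
      rw [hV', Set.indicator_of_mem htS]
      exact hV0 t htS (not_le.1 hcon)
    have hxt : ‖x - t‖ ≤ 3 * r n := by
      have : x - t = s - c n := by rw [sub_eq_sub_iff_add_eq_add, hst]
      rw [this]
      refine (norm_sub_le _ _).trans ?_
      rw [hcn]; linarith
    refine ⟨?_, t, htS, hxt⟩
    have h1 := (lipschitzWith_sideDist L).dist_le_mul t x
    rw [NNReal.coe_one, one_mul, dist_comm t x, dist_eq_norm x t, Real.dist_eq] at h1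
    linarith [(abs_le.1 (h1.trans hxt)).2]
  have hbdd : ∃ R, ∀ x ∈ S, ‖x‖ ≤ R := by
    refine ⟨2 * |L|, fun x hx => ?_⟩
    obtain ⟨⟨h1, h2⟩, h3, h4⟩ := hx
    rw [EuclideanSpace.norm_eq, Fin.sum_univ_two]
    refine Real.sqrt_le_iff.2 ⟨by positivity, ?_⟩
    rw [abs_of_pos (h1.trans h2), Real.norm_eq_abs, Real.norm_eq_abs, sq_abs, sq_abs]
    nlinarith
  obtain ⟨R, hR⟩ := hbdd
  have hφC : ∀ n, ContDiff ℝ ∞ (φ n) := fun n =>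
    (contDiff_conv (isTest_mollifier n) hV'li).comp (contDiff_id.add contDiff_const)
  have htest : ∀ n, 3 * r n < δ / 2 → IsTestV L (φ n) := by
    intro n hn
    refine ⟨⟨hφC n, ?_⟩, ?_⟩
    · refine HasCompactSupport.intro (isCompact_closedBall (0 : Plane) (R + 3 * r n))
        fun x hx => ?_
      by_contra hcon
      obtain ⟨-, y, hy, hxy⟩ := hsupp n hn x hcon
      refine hx (mem_closedBall_zero_iff.2 ?_)
      have h1 := norm_add_le (x - y) y
      rw [sub_add_cancel] at h1
      linarith [hR y hy]
    · rw [Set.disjoint_left]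
      intro x hx hxD
      have h1 : x ∈ {x | δ / 2 ≤ sideDist L x} :=
        closure_minimal (fun y hy => show δ / 2 ≤ sideDist L y from (hsupp n hn y hy).1)
          (isClosed_le continuous_const (lipschitzWith_sideDist L).continuous) hx
      have h2 : δ / 2 ≤ sideDist L x := h1
      linarith [sideDist_nonpos_of_mem_dirichletPart hxD]
  -- on the square the gradient may be moved under the convolution: `mollifier n (z - ·)` is supported
  -- in the upper half-plane, because the translation by `2 * r n` exceeds the radius `r n`
  have hgrad : ∀ n, ∀ x ∈ S, ∀ i, gradient (φ n) x i = conv (mollifier n) (W' i) (x + c n) := by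
    intro n x hx i
    set z := x + c n with hz
    have hz1 : 2 * r n < z 1 := by
      have h1 : z 1 = x 1 + 2 * r n := by rw [hz, PiLp.add_apply, hc1]
      rw [h1]; linarith [(mem_square_iff.1 hx).2]
    have hsubt : ∀ f g : Plane → ℝ,
        conv f (S.indicator g) z = ∫ y in S, g y * f (z - y) := by
      intro f g
      rw [conv_apply, ← integral_sub_left_eq_self _ volume z, ← integral_indicator hSm]
      refine integral_congr_ae (Eventually.of_forall fun y => ?_)
      by_cases hy : y ∈ S
      · simp [hy, mul_comm]
      · simp [hy]
    have hm := isTest_mollifier n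
    have hflip : IsTest fun y => mollifier n (z - y) :=
      ⟨hm.1.comp (contDiff_const.sub contDiff_id), hm.2.comp_homeomorph (Homeomorph.subLeft z)⟩
    have hts : tsupport (fun y => mollifier n (z - y)) ⊆ {y | 0 < y 1} := by
      have h1 : tsupport (fun y => mollifier n (z - y)) ⊆ Metric.closedBall z (r n) := by
        refine closure_minimal (fun y hy => ?_) Metric.isClosed_closedBall
        rw [Metric.mem_closedBall', dist_eq_norm]
        by_contra hcon
        exact hy (mollifier_eq_zero (le_of_lt (not_le.1 hcon)))
      intro y hy
      have h2 := h1 hy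
      rw [Metric.mem_closedBall', dist_eq_norm] at h2
      have h3 := (abs_le.1 ((abs_coord_le (z - y) 1).trans h2)).2
      rw [PiLp.sub_apply] at h3
      change 0 < y 1
      linarith [hrpos n]
    rw [gradient_apply_eq_partialDeriv ((hφC n).differentiable (by simp) x), hφ,
      partialDeriv_comp_add, partialDeriv_conv hm hV'li, hsubt, hsubt]
    have h := hVW.integral_eq_of_vanishing hδ hV0 hW0 hflip hts i
    simp only [partialDeriv_comp_sub_left, mul_neg, integral_neg, neg_inj] at h
    exact h
  have hzero : ∀ n, 3 * r n < δ / 2 → ∑ i, conv (mollifier n) (A i) (c n) = 0 := by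
    intro n hn
    rw [← hweak (φ n) (htest n hn)]
    simp only [inner_eq_sum]
    rw [integral_finsetSum]
    · refine Finset.sum_congr rfl fun i _ => ?_
      rw [hA, ← integral_mul_conv_translate (hF'L i) (hW'L i) (isTest_mollifier n).1.continuous
        (isTest_mollifier n).2, ← integral_indicator hSm]
      refine integral_congr_ae (Eventually.of_forall fun x => ?_)
      by_cases hx : x ∈ S
      · simp only [hF', Set.indicator_of_mem hx, hgrad n x hx i]
      · simp only [hF', Set.indicator_of_notMem hx, zero_mul]
    · intro i _
      exact (memLp_coord hF i).integrable_mul (memLp_coord ((htest n hn).1.memLp_gradient S) i)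
  have hlim : Tendsto (fun n => ∑ i, conv (mollifier n) (A i) (c n)) atTop
      (𝓝 (∑ i, A i 0)) := by
    refine tendsto_finsetSum _ fun i _ => ?_
    have hc0 : Tendsto c atTop (𝓝 0) := by
      rw [tendsto_zero_iff_norm_tendsto_zero]
      simp only [hcn]
      simpa using hr0.const_mul 2
    exact ContDiffBump.convolution_tendsto_right hr0
      (g := fun _ => A i) (Eventually.of_forall fun _ => (hAc i).aestronglyMeasurable)
      (((hAc i).tendsto 0).comp tendsto_snd) hc0
  have hsum : ∑ i, A i 0 = 0 := by
    refine tendsto_nhds_unique hlim (tendsto_const_nhds.congr' ?_)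
    have h3 : Tendsto (fun n => 3 * r n) atTop (𝓝 0) := by simpa using hr0.const_mul 3
    filter_upwards [h3.eventually (gt_mem_nhds (show 0 < δ / 2 by positivity))] with n hn
    exact (hzero n hn).symm
  rw [← hsum]
  simp only [inner_eq_sum]
  rw [integral_finsetSum]
  · refine Finset.sum_congr rfl fun i _ => ?_
    rw [hA, ← integral_indicator hSm]
    refine integral_congr_ae (Eventually.of_forall fun x => ?_)
    by_cases hx : x ∈ S
    · simp [hF', hW', hx]
    · simp [hF', hx]
  · exact fun i _ => (memLp_coord hF i).integrable_mul (memLp_coord hW i)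

/-! ### The boundary layer at scale `ε` -/

variable {L ε : ℝ} {K : ℝ≥0} {b : Plane → ℝ}

lemma partialDeriv_comp_smul (f : Plane → ℝ) (c : ℝ) (x : Plane) (i : Fin 2) :
    partialDeriv i (fun y => f (c • y)) x = c * partialDeriv i f (c • x) := by
  have h := deriv_comp_mul_left c (fun t : ℝ => f (c • x + t • EuclideanSpace.single i (1 : ℝ))) 0
  rw [mul_zero, smul_eq_mul] at h
  rw [partialDeriv, lineDeriv, partialDeriv, lineDeriv, ← h]
  congr 1
  funext t
  rw [smul_add, smul_smul]

lemma IsDecaying.lipschitzWith_scaled (hb : IsDecaying K b) (ε : ℝ) :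
    LipschitzWith (K * ‖ε⁻¹‖₊) fun x => b (ε⁻¹ • x) :=
  hb.lipschitz.comp (lipschitzWith_smul ε⁻¹)

lemma IsDecaying.abs_scaled_le (hb : IsDecaying K b) (hε : 0 < ε) {x : Plane} (hx : 0 ≤ x 1) :
    |b (ε⁻¹ • x)| ≤ K * Real.exp (-(x 1 / ε)) := by
  have h1 : (ε⁻¹ • x) 1 = x 1 / ε := by rw [PiLp.smul_apply, smul_eq_mul, inv_mul_eq_div]
  have h := hb.abs_le (ε⁻¹ • x) (by rw [h1]; positivity)
  rwa [h1] at h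

lemma IsDecaying.norm_lipGrad_scaled_le (hb : IsDecaying K b) (hε : 0 < ε) {x : Plane}
    (hx : 0 ≤ x 1) :
    ‖lipGrad (fun x => b (ε⁻¹ • x)) x‖ ≤ 2 * (ε⁻¹ * (K * Real.exp (-(x 1 / ε)))) := by
  have h1 : (ε⁻¹ • x) 1 = x 1 / ε := by rw [PiLp.smul_apply, smul_eq_mul, inv_mul_eq_div]
  refine norm_lipGrad_le fun i => ?_
  have h := hb.lineDeriv_le (ε⁻¹ • x) i (by rw [h1]; positivity)
  rw [h1] at h
  rw [partialDeriv_comp_smul, abs_mul, abs_of_pos (by positivity : 0 < ε⁻¹)]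
  exact mul_le_mul_of_nonneg_left h (by positivity)

/-- A function that dominates `exp (-x₂/ε)` at distance at most `2ε` from the lateral and top sides
of the square; near the top side because `x₁ < L ≤ x₂ + 2ε` there. -/
noncomputable def layerWeight (L ε : ℝ) (x : Plane) : ℝ :=
  Real.exp 1 * (Real.exp (-(x 0 / (2 * ε))) * Real.exp (-(x 1 / (2 * ε))) +
    Real.exp (-((L - x 0) / (2 * ε))) * Real.exp (-(x 1 / (2 * ε))))

lemma exp_le_layerWeight (hε : 0 < ε) {x : Plane} (hx : x ∈ square L)
    (hd : sideDist L x ≤ 2 * ε) : Real.exp (-(x 1 / ε)) ≤ layerWeight L ε x := by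
  obtain ⟨⟨h1, h2⟩, h3, h4⟩ := hx
  have e1 : layerWeight L ε x = Real.exp (1 + -(x 0 / (2 * ε)) + -(x 1 / (2 * ε))) +
      Real.exp (1 + -((L - x 0) / (2 * ε)) + -(x 1 / (2 * ε))) := by
    rw [layerWeight]
    simp only [Real.exp_add]
    ring
  have hsplit : -(x 1 / ε) = -(x 1 / (2 * ε)) + -(x 1 / (2 * ε)) := by field_simp; ring
  have hpos : 0 ≤ x 1 / (2 * ε) := by positivity
  rw [e1]
  rcases min_le_iff.1 hd with h | h
  · rcases min_le_iff.1 h with h | h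
    · have h5 : x 0 / (2 * ε) ≤ 1 := (div_le_one (by positivity)).2 h
      refine le_add_of_le_of_nonneg (Real.exp_le_exp.2 ?_) (Real.exp_nonneg _)
      rw [hsplit]; linarith
    · have h5 : (L - x 0) / (2 * ε) ≤ 1 := (div_le_one (by positivity)).2 h
      refine le_add_of_nonneg_of_le (Real.exp_nonneg _) (Real.exp_le_exp.2 ?_)
      rw [hsplit]; linarith
  · have h5 : x 0 / (2 * ε) ≤ 1 + x 1 / (2 * ε) := by
      rw [← sub_le_iff_le_add, ← sub_div, div_le_one (by positivity)]
      linarith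
    refine le_add_of_le_of_nonneg (Real.exp_le_exp.2 ?_) (Real.exp_nonneg _)
    rw [hsplit]; linarith

lemma lintegral_square_mul {f g : ℝ → ℝ≥0∞} (hf : Measurable f) (hg : Measurable g) (L : ℝ) :
    ∫⁻ x in square L, f (x 0) * g (x 1) =
      (∫⁻ s in Set.Ioo 0 L, f s) * ∫⁻ s in Set.Ioo 0 L, g s := by
  have hm : MeasurePreserving (fun x : Plane => (x 0, x 1)) volume
      ((volume : Measure ℝ).prod volume) :=
    (volume_preserving_finTwoArrow ℝ).comp
      (EuclideanSpace.volume_preserving_symm_measurableEquiv_toLp (Fin 2))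
  have hS : square L = (fun x : Plane => (x 0, x 1)) ⁻¹' (Set.Ioo 0 L ×ˢ Set.Ioo 0 L) := by
    ext x
    simp [square]
  have hm' := hm.restrict_preimage
    ((measurableSet_Ioo (a := (0 : ℝ)) (b := L)).prod (measurableSet_Ioo (a := (0 : ℝ)) (b := L)))
  rw [← hS] at hm'
  rw [hm'.lintegral_comp (f := fun p : ℝ × ℝ => f p.1 * g p.2)
    ((hf.comp measurable_fst).mul (hg.comp measurable_snd)), ← Measure.prod_restrict,
    lintegral_prod_mul hf.aemeasurable hg.aemeasurable]

lemma integral_exp_neg_div_le (L : ℝ) (hε : 0 < ε) :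
    ∫ s in (0 : ℝ)..L, Real.exp (-(s / ε)) ≤ ε := by
  have h : ∀ s : ℝ, HasDerivAt (fun s => -ε * Real.exp (-(s / ε))) (Real.exp (-(s / ε))) s := by
    intro s
    have h1 := (((hasDerivAt_id s).div_const ε).neg.exp).const_mul (-ε)
    convert! h1 using 1
    simp only [id, Pi.neg_apply]
    field_simp
  rw [intervalIntegral.integral_eq_sub_of_hasDerivAt (fun s _ => h s)
    (Continuous.intervalIntegrable (by fun_prop) _ _)]
  have := Real.exp_pos (-(L / ε))
  simp only [zero_div, neg_zero, Real.exp_zero]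
  nlinarith

lemma lintegral_le_of_intervalIntegral_le {f : ℝ → ℝ} (hL : 0 < L) (hf : Continuous f)
    (h0 : ∀ s, 0 ≤ f s) {B : ℝ} (hB : ∫ s in (0 : ℝ)..L, f s ≤ B) :
    ∫⁻ s in Set.Ioo 0 L, ENNReal.ofReal (f s) ≤ ENNReal.ofReal B := by
  rw [intervalIntegral.integral_of_le hL.le, integral_Ioc_eq_integral_Ioo] at hB
  rw [← ofReal_integral_eq_lintegral_ofReal _ (Eventually.of_forall h0)]
  · exact ENNReal.ofReal_le_ofReal hB
  · exact (hf.integrableOn_Icc (a := 0) (b := L)).mono_set Set.Ioo_subset_Icc_self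

lemma eLpNorm_mul_square_le {p q : ℝ → ℝ} (hL : 0 < L) (hp : Continuous p) (hq : Continuous q)
    {B : ℝ} (hpB : ∫ s in (0 : ℝ)..L, p s ^ 2 ≤ B)
    (hqB : ∫ s in (0 : ℝ)..L, q s ^ 2 ≤ B) :
    eLpNorm (fun x : Plane => p (x 0) * q (x 1)) 2 (volume.restrict (square L)) ≤
      ENNReal.ofReal B := by
  rw [eLpNorm_eq_lintegral_rpow_enorm_toReal (by simp) (by simp)]
  have h1 : ∀ x : Plane, ‖p (x 0) * q (x 1)‖ₑ ^ (2 : ℝ≥0∞).toReal =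
      ENNReal.ofReal (p (x 0) ^ 2) * ENNReal.ofReal (q (x 1) ^ 2) := by
    intro x
    rw [← ENNReal.ofReal_mul (by positivity), ENNReal.toReal_ofNat, ENNReal.rpow_ofNat,
      ← ofReal_norm, ← ENNReal.ofReal_pow (norm_nonneg _), Real.norm_eq_abs, sq_abs,
      mul_pow]
  simp only [h1]
  rw [lintegral_square_mul (f := fun s => ENNReal.ofReal (p s ^ 2))
    (g := fun s => ENNReal.ofReal (q s ^ 2)) (by fun_prop) (by fun_prop)]
  have h2 := lintegral_le_of_intervalIntegral_le hL (f := fun s => p s ^ 2) (hp.pow 2)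
    (fun s => sq_nonneg _) hpB
  have h3 := lintegral_le_of_intervalIntegral_le hL (f := fun s => q s ^ 2) (hq.pow 2)
    (fun s => sq_nonneg _) hqB
  calc _ ≤ (ENNReal.ofReal B * ENNReal.ofReal B) ^ (1 / (2 : ℝ≥0∞).toReal) := by
        gcongr
    _ = ENNReal.ofReal B := by
        rw [← sq, ← ENNReal.rpow_ofNat, ← ENNReal.rpow_mul]
        simp

/-- The boundary layer has `L²` norm of order `ε`, uniformly in the size of the square. -/
lemma eLpNorm_layerWeight_le (hL : 0 < L) (hε : 0 < ε) :
    eLpNorm (layerWeight L ε) 2 (volume.restrict (square L)) ≤ ENNReal.ofReal (6 * ε) := by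
  have hsq : ∀ s : ℝ, Real.exp (-(s / (2 * ε))) ^ 2 = Real.exp (-(s / ε)) := fun s => by
    rw [← Real.exp_nat_mul]
    congr 1
    push_cast
    field_simp
  have hI := integral_exp_neg_div_le L hε
  have hI' : ∫ s in (0 : ℝ)..L, Real.exp (-((L - s) / ε)) ≤ ε := by
    have h := intervalIntegral.integral_comp_sub_left (a := 0) (b := L)
      (fun s => Real.exp (-(s / ε))) L
    rw [h]
    simpa using hI
  set q : ℝ → ℝ := fun s => Real.exp (-(s / (2 * ε))) with hq
  have hqc : Continuous q := by fun_prop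
  have h1 := eLpNorm_mul_square_le hL hqc hqc (by simpa only [hq, hsq] using hI)
    (by simpa only [hq, hsq] using hI)
  have h2 := eLpNorm_mul_square_le hL (p := fun s => q (L - s))
    (hqc.comp (continuous_const.sub continuous_id)) hqc
    (by simpa only [hq, hsq] using hI') (by simpa only [hq, hsq] using hI)
  have hc0 := continuous_coord 0
  have hc1 := continuous_coord 1
  have hm1 : AEStronglyMeasurable (fun x : Plane => q (x 0) * q (x 1))
      (volume.restrict (square L)) :=
    ((hqc.comp hc0).mul (hqc.comp hc1)).aestronglyMeasurable
  have hm2 : AEStronglyMeasurable (fun x : Plane => q (L - x 0) * q (x 1))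
      (volume.restrict (square L)) :=
    ((hqc.comp (continuous_const.sub hc0)).mul (hqc.comp hc1)).aestronglyMeasurable
  have he : layerWeight L ε = Real.exp 1 •
      ((fun x : Plane => q (x 0) * q (x 1)) + fun x : Plane => q (L - x 0) * q (x 1)) := rfl
  rw [he, eLpNorm_const_smul]
  calc _ ≤ ‖Real.exp 1‖ₑ * (ENNReal.ofReal ε + ENNReal.ofReal ε) := by
        gcongr
        exact (eLpNorm_add_le hm1 hm2 one_le_two).trans (add_le_add h1 h2)
    _ ≤ ENNReal.ofReal (6 * ε) := by
        rw [← ENNReal.ofReal_add hε.le hε.le, ← ofReal_norm,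
          ← ENNReal.ofReal_mul (norm_nonneg _), Real.norm_of_nonneg (Real.exp_nonneg _)]
        refine ENNReal.ofReal_le_ofReal ?_
        nlinarith [Real.exp_one_lt_d9]

/-! ### The energy estimate -/

lemma eLpNorm_le_of_integral_inner_eq {α : Type*} [MeasurableSpace α] {μ : Measure α}
    {f g : α → Plane} (hf : MemLp f 2 μ) (hg : MemLp g 2 μ)
    (h : ∫ x, inner ℝ (f x) (f x) ∂μ = ∫ x, inner ℝ (f x) (g x) ∂μ) :
    eLpNorm f 2 μ ≤ eLpNorm g 2 μ := by
  have e : ∀ {g' : α → Plane} (hg' : MemLp g' 2 μ),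
      inner ℝ (hf.toLp f) (hg'.toLp g') = ∫ x, inner ℝ (f x) (g' x) ∂μ := by
    intro g' hg'
    rw [L2.inner_def]
    refine integral_congr_ae ?_
    filter_upwards [hf.coeFn_toLp, hg'.coeFn_toLp] with x hx hx'
    rw [hx, hx']
  rw [← e hf, ← e hg, real_inner_self_eq_norm_sq] at h
  have h1 := h.trans_le (real_inner_le_norm _ _)
  have h2 : ‖hf.toLp f‖ ≤ ‖hg.toLp g‖ := by
    by_contra hcon
    nlinarith [norm_nonneg (hg.toLp g), norm_nonneg (hf.toLp f)]
  rw [Lp.norm_toLp, Lp.norm_toLp] at h2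
  exact (ENNReal.toReal_le_toReal hf.2.ne hg.2.ne).1 h2

/-- The energy of the harmonic corrector is at most that of `η u₁`, where `η = 1 - cutoff L ε`: both
have the same trace on the Dirichlet part of the boundary, and `(1 - η) u₁` is orthogonal to the
corrector. -/
theorem IsCorrector.eLpNorm_le {u₁ w : Plane → ℝ} {G W₁ : Plane → Plane} (hε : 0 < ε)
    (hw : IsCorrector L u₁ w G) (hu₁ : IsWeakGrad (square L) u₁ W₁) :
    eLpNorm G 2 (volume.restrict (square L)) ≤
      eLpNorm (fun x => (1 - cutoff L ε x) • W₁ x - u₁ x • lipGrad (cutoff L ε) x) 2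
        (volume.restrict (square L)) := by
  obtain ⟨Gd, hGd⟩ := hw.dirichlet
  set μ := volume.restrict (square L) with hμ
  set θ := cutoff L ε with hθ
  have hθL := lipschitzWith_cutoff L ε hε
  have hae : ∀ᵐ x ∂μ, W₁ x = G x - Gd x := by
    have h1 := hw.memH1.weakGrad.sub hGd.1.weakGrad
    simp only [sub_sub_cancel] at h1
    exact hu₁.ae_eq (isOpen_square L) h1
  have hG := hw.memH1.memLp_grad
  have hW₁L : MemLp W₁ 2 μ := (hG.sub hGd.1.memLp_grad).ae_eq (hae.mono fun x hx => hx.symm)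
  have hu₁L : MemLp u₁ 2 μ := by
    have h1 := hw.memH1.memLp.sub hGd.1.memLp
    convert! h1 using 1
    funext x
    simp
  have hθm : AEStronglyMeasurable θ μ := hθL.continuous.aestronglyMeasurable
  have hθ1 : ∀ x, ‖θ x‖ ≤ 1 := fun x => by
    rw [Real.norm_of_nonneg (cutoff_nonneg L ε x)]
    exact cutoff_le_one L ε x
  have hVL : MemLp (fun x => θ x * u₁ x) 2 μ := by
    refine hu₁L.of_le (hθm.mul hu₁L.1) (Eventually.of_forall fun x => ?_)
    rw [norm_mul]
    exact mul_le_of_le_one_left (norm_nonneg _) (hθ1 x)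
  have hθW : MemLp (fun x => θ x • W₁ x) 2 μ := by
    refine hW₁L.of_le (hθm.smul hW₁L.1) (Eventually.of_forall fun x => ?_)
    rw [norm_smul]
    exact mul_le_of_le_one_left (norm_nonneg _) (hθ1 x)
  have hgθ : MemLp (fun x => u₁ x • lipGrad θ x) 2 μ := by
    refine (hu₁L.norm.const_mul (2 * (Real.toNNReal ε⁻¹ : ℝ))).of_le
      (hu₁L.1.smul (measurable_lipGrad hθL.continuous).aestronglyMeasurable)
      (Eventually.of_forall fun x => ?_)
    rw [norm_smul, norm_mul, norm_norm, mul_comm, Real.norm_of_nonneg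
      (mul_nonneg zero_le_two (NNReal.coe_nonneg _))]
    exact mul_le_mul_of_nonneg_right (norm_lipGrad_le fun i => abs_partialDeriv_le hθL i x)
      (norm_nonneg _)
  set W : Plane → Plane := fun x => u₁ x • lipGrad θ x + θ x • W₁ x with hW
  have hWL : MemLp W 2 μ := hgθ.add hθW
  have hzero : ∫ x in square L, inner ℝ (G x) (W x) = 0 := by
    refine integral_inner_eq_zero_of_vanishing hε hG
      (fun φ hφ => hw.weak_eq φ (gradient φ) hφ.memV) hVL hWL
      (hu₁.lipschitz_mul (isOpen_square L) hθL) (fun x _ hd => ?_) (fun x _ hd => ?_)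
    · rw [hθ, cutoff_eq_zero hε hd.le, zero_mul]
    · rw [hW]
      simp only [hθ, cutoff_eq_zero hε hd.le, lipGrad_cutoff_eq_zero_of_lt hε hd, smul_zero,
        zero_smul, add_zero]
  -- as `W₁ = G - Gd` almost everywhere, `‖G‖² = ⟨G, W₁⟩ = ⟨G, W₁ - W⟩`
  have hzero' : ∫ x in square L, inner ℝ (G x) (Gd x) = 0 := hw.weak_eq _ Gd hGd
  have hR : (fun x => (1 - θ x) • W₁ x - u₁ x • lipGrad θ x) = fun x => W₁ x - W x := by
    funext x
    rw [hW]
    module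
  rw [hR]
  have hint : ∀ {f : Plane → Plane}, MemLp f 2 μ → Integrable (fun x => inner ℝ (G x) (f x)) μ :=
    fun hf => by
      simp only [inner_eq_sum]
      exact integrable_finsetSum _ fun i _ => (memLp_coord hG i).integrable_mul (memLp_coord hf i)
  refine eLpNorm_le_of_integral_inner_eq hG (hW₁L.sub hWL) ?_
  simp only [inner_sub_right]
  rw [integral_sub (hint hW₁L) (hint hWL), hzero, sub_zero]
  have h2 : ∫ x, inner ℝ (G x) (W₁ x) ∂μ =
      ∫ x, (inner ℝ (G x) (G x) - inner ℝ (G x) (Gd x)) ∂μ := by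
    refine integral_congr_ae ?_
    filter_upwards [hae] with x hx
    rw [hx, inner_sub_right]
  rw [h2, integral_sub (hint hG) (hint hGd.1.memLp_grad), hzero', sub_zero]

variable {L ε m : ℝ} {K : ℝ≥0} {b₀ b₁ b₂ : Plane → ℝ} {G : Plane → Plane}
  {H : Plane → PiLp 2 (fun _ : Fin 2 => Plane)}

/-- The gradient of `b₀(x/ε) + b₁(x/ε) G₁ + b₂(x/ε) G₂`, by the product rule. -/
noncomputable def correctionGrad (ε : ℝ) (b₀ b₁ b₂ : Plane → ℝ) (G : Plane → Plane)
    (H : Plane → PiLp 2 (fun _ : Fin 2 => Plane)) (x : Plane) : Plane :=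
  lipGrad (fun x => b₀ (ε⁻¹ • x)) x +
    (G x 0 • lipGrad (fun x => b₁ (ε⁻¹ • x)) x + b₁ (ε⁻¹ • x) • H x 0) +
    (G x 1 • lipGrad (fun x => b₂ (ε⁻¹ • x)) x + b₂ (ε⁻¹ • x) • H x 1)

lemma isWeakGrad_correction {Ω : Set Plane} (hΩ : IsOpen Ω) (h₀ : IsDecaying K b₀)
    (h₁ : IsDecaying K b₁) (h₂ : IsDecaying K b₂) (hH : IsWeakHessian Ω G H) (ε : ℝ) :
    IsWeakGrad Ω (fun x => b₀ (ε⁻¹ • x) + b₁ (ε⁻¹ • x) * G x 0 + b₂ (ε⁻¹ • x) * G x 1)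
      (correctionGrad ε b₀ b₁ b₂ G H) :=
  ((isWeakGrad_of_lipschitz hΩ (h₀.lipschitzWith_scaled ε)).add
    ((hH 0).lipschitz_mul hΩ (h₁.lipschitzWith_scaled ε))).add
    ((hH 1).lipschitz_mul hΩ (h₂.lipschitzWith_scaled ε))

/-- The gradient of `(1 - θ) u₁` is carried by the boundary layer, up to a term controlled by the
Hessian. -/
lemma norm_layer_le (hε : 0 < ε) (h₀ : IsDecaying K b₀) (h₁ : IsDecaying K b₁)
    (h₂ : IsDecaying K b₂) {x : Plane} (hx : x ∈ square L) (hG : ‖G x‖ ≤ m) :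
    ‖(1 - cutoff L ε x) • correctionGrad ε b₀ b₁ b₂ G H x -
      (b₀ (ε⁻¹ • x) + b₁ (ε⁻¹ • x) * G x 0 + b₂ (ε⁻¹ • x) * G x 1) • lipGrad (cutoff L ε) x‖ ≤
      ‖4 * ε⁻¹ * K * (1 + 2 * m) * layerWeight L ε x + 2 * K * ‖H x‖‖ := by
  have hm : 0 ≤ m := (norm_nonneg _).trans hG
  have hlw : 0 ≤ layerWeight L ε x := by rw [layerWeight]; positivity
  have hK := K.coe_nonneg
  have hε' : 0 < ε⁻¹ := by positivity
  rw [Real.norm_of_nonneg (by positivity)]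
  rcases lt_or_ge (2 * ε) (sideDist L x) with hd | hd
  · rw [cutoff_eq_one hε hd.le, lipGrad_cutoff_eq_zero_of_gt hε hd]
    simp only [sub_self, zero_smul, smul_zero, norm_zero]
    positivity
  have hx1 : 0 ≤ x 1 := (mem_square_iff.1 hx).2.le
  set E := Real.exp (-(x 1 / ε)) with hE
  have hE0 : 0 < E := Real.exp_pos _
  have hE1 : E ≤ 1 := Real.exp_le_one_iff.2 (by simp only [Left.neg_nonpos_iff]; positivity)
  have hEw : E ≤ layerWeight L ε x := exp_le_layerWeight hε hx hd
  have hGi : ∀ i, |G x i| ≤ m := fun i => (abs_coord_le _ i).trans hG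
  have hHi : ∀ i, ‖H x i‖ ≤ ‖H x‖ := fun i => PiLp.norm_apply_le (H x) i
  have hb : ∀ {b : Plane → ℝ}, IsDecaying K b → |b (ε⁻¹ • x)| ≤ K * E := fun h =>
    h.abs_scaled_le hε hx1
  have hbg : ∀ {b : Plane → ℝ}, IsDecaying K b →
      ‖lipGrad (fun x => b (ε⁻¹ • x)) x‖ ≤ 2 * (ε⁻¹ * (K * E)) := fun h =>
    h.norm_lipGrad_scaled_le hε hx1
  have hterm : ∀ {b : Plane → ℝ} (i : Fin 2), IsDecaying K b →
      ‖G x i • lipGrad (fun x => b (ε⁻¹ • x)) x + b (ε⁻¹ • x) • H x i‖ ≤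
        m * (2 * (ε⁻¹ * (K * E))) + K * ‖H x‖ := by
    intro b i h
    refine (norm_add_le _ _).trans (add_le_add ?_ ?_)
    · rw [norm_smul]
      exact mul_le_mul (hGi i) (hbg h) (norm_nonneg _) hm
    · rw [norm_smul]
      refine mul_le_mul ((hb h).trans (mul_le_of_le_one_right hK hE1)) (hHi i)
        (norm_nonneg _) hK
  have hW : ‖correctionGrad ε b₀ b₁ b₂ G H x‖ ≤
      2 * ε⁻¹ * K * (1 + 2 * m) * E + 2 * K * ‖H x‖ := by
    have h3 := norm_add₃_le (a := lipGrad (fun x => b₀ (ε⁻¹ • x)) x)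
      (b := G x 0 • lipGrad (fun x => b₁ (ε⁻¹ • x)) x + b₁ (ε⁻¹ • x) • H x 0)
      (c := G x 1 • lipGrad (fun x => b₂ (ε⁻¹ • x)) x + b₂ (ε⁻¹ • x) • H x 1)
    rw [correctionGrad]
    linarith [hbg h₀, hterm 0 h₁, hterm 1 h₂]
  have hu : |b₀ (ε⁻¹ • x) + b₁ (ε⁻¹ • x) * G x 0 + b₂ (ε⁻¹ • x) * G x 1| ≤
      K * (1 + 2 * m) * E := by
    have h3 := abs_add_three (b₀ (ε⁻¹ • x)) (b₁ (ε⁻¹ • x) * G x 0) (b₂ (ε⁻¹ • x) * G x 1)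
    rw [abs_mul, abs_mul] at h3
    have h4 := mul_le_mul (hb h₁) (hGi 0) (abs_nonneg _) (by positivity)
    have h5 := mul_le_mul (hb h₂) (hGi 1) (abs_nonneg _) (by positivity)
    linarith [hb h₀]
  have hθ : ‖lipGrad (cutoff L ε) x‖ ≤ 2 * ε⁻¹ := by
    refine norm_lipGrad_le fun i => ?_
    have h := abs_partialDeriv_le (lipschitzWith_cutoff L ε hε) i x
    rwa [Real.coe_toNNReal _ hε'.le] at h
  have h1θ : ‖1 - cutoff L ε x‖ ≤ 1 := by
    rw [Real.norm_of_nonneg (by linarith [cutoff_le_one L ε x])]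
    linarith [cutoff_nonneg L ε x]
  calc _ ≤ ‖1 - cutoff L ε x‖ * ‖correctionGrad ε b₀ b₁ b₂ G H x‖ +
        |b₀ (ε⁻¹ • x) + b₁ (ε⁻¹ • x) * G x 0 + b₂ (ε⁻¹ • x) * G x 1| *
          ‖lipGrad (cutoff L ε) x‖ := by
        rw [← norm_smul, ← Real.norm_eq_abs, ← norm_smul]
        exact norm_sub_le _ _
    _ ≤ 1 * (2 * ε⁻¹ * K * (1 + 2 * m) * E + 2 * K * ‖H x‖) +
        K * (1 + 2 * m) * E * (2 * ε⁻¹) :=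
        add_le_add (mul_le_mul h1θ hW (norm_nonneg _) zero_le_one)
          (mul_le_mul hu hθ (norm_nonneg _) (by positivity))
    _ = 4 * ε⁻¹ * K * (1 + 2 * m) * E + 2 * K * ‖H x‖ := by ring
    _ ≤ _ := by gcongr

/-- The corrector estimate for arbitrary Lipschitz functions `b₀`, `b₁`, `b₂` which decay with their
gradients like `exp (-ξ₂)`. -/
theorem IsCorrector.eLpNorm_le_of_isDecaying (hL : 0 < L) (hε : 0 < ε) (h₀ : IsDecaying K b₀)
    (h₁ : IsDecaying K b₁) (h₂ : IsDecaying K b₂) (hH : IsWeakHessian (square L) G H)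
    (hG : MemLp G ∞ (volume.restrict (square L))) (hH2 : MemLp H 2 (volume.restrict (square L)))
    {w : Plane → ℝ} {Gw : Plane → Plane}
    (hw : IsCorrector L
      (fun x => b₀ (ε⁻¹ • x) + b₁ (ε⁻¹ • x) * G x 0 + b₂ (ε⁻¹ • x) * G x 1) w Gw) :
    eLpNorm Gw 2 (volume.restrict (square L)) ≤
      (48 * K : ℝ≥0) * (1 + eLpNorm G ∞ (volume.restrict (square L))
        + eLpNorm H 2 (volume.restrict (square L))) := by
  set μ := volume.restrict (square L) with hμ
  set m := (eLpNorm G ∞ μ).toReal with hm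
  have hm0 : 0 ≤ m := ENNReal.toReal_nonneg
  have hmG : ENNReal.ofReal m = eLpNorm G ∞ μ := ENNReal.ofReal_toReal hG.2.ne
  have hGm : ∀ᵐ x ∂μ, ‖G x‖ ≤ m := by
    have h := ae_le_eLpNormEssSup (f := G) (μ := μ)
    filter_upwards [h] with x hx
    rw [← eLpNorm_exponent_top, ← hmG, ← ofReal_norm] at hx
    exact (ENNReal.ofReal_le_ofReal_iff hm0).1 hx
  set c : ℝ := 4 * ε⁻¹ * K * (1 + 2 * m) with hc
  have hc0 : 0 ≤ c := by positivity
  have hlm : AEStronglyMeasurable (layerWeight L ε) μ := by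
    have hc0 := continuous_coord 0
    have hc1 := continuous_coord 1
    refine Continuous.aestronglyMeasurable ?_
    unfold layerWeight
    fun_prop
  have hpt : ∀ᵐ x ∂μ, ‖(1 - cutoff L ε x) • correctionGrad ε b₀ b₁ b₂ G H x -
      (b₀ (ε⁻¹ • x) + b₁ (ε⁻¹ • x) * G x 0 + b₂ (ε⁻¹ • x) * G x 1) •
        lipGrad (cutoff L ε) x‖ ≤ ‖(c • layerWeight L ε + (2 * (K : ℝ)) • fun x => ‖H x‖) x‖ := by
    filter_upwards [hGm, ae_restrict_mem (isOpen_square L).measurableSet] with x hx hxS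
    exact norm_layer_le hε h₀ h₁ h₂ hxS hx
  have hcw : eLpNorm (c • layerWeight L ε) 2 μ ≤ ENNReal.ofReal (24 * K * (1 + 2 * m)) := by
    rw [eLpNorm_const_smul, ← ofReal_norm, Real.norm_of_nonneg hc0]
    refine (mul_le_mul_right (eLpNorm_layerWeight_le hL hε) _).trans ?_
    rw [← ENNReal.ofReal_mul hc0]
    refine ENNReal.ofReal_le_ofReal (le_of_eq ?_)
    rw [hc]
    field_simp
    ring
  have hK2 : ‖2 * (K : ℝ)‖ₑ ≤ ((48 * K : ℝ≥0) : ℝ≥0∞) := by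
    rw [← ofReal_norm, Real.norm_of_nonneg (by positivity)]
    refine ENNReal.ofReal_le_of_le_toReal ?_
    rw [ENNReal.coe_toReal]
    push_cast
    linarith [K.coe_nonneg]
  have hKm : ENNReal.ofReal (24 * K * (1 + 2 * m)) ≤
      ((48 * K : ℝ≥0) : ℝ≥0∞) * (1 + eLpNorm G ∞ μ) := by
    rw [← hmG, ← ENNReal.ofReal_one, ← ENNReal.ofReal_add zero_le_one hm0,
      ← ENNReal.ofReal_coe_nnreal, ← ENNReal.ofReal_mul (NNReal.coe_nonneg _)]
    refine ENNReal.ofReal_le_ofReal ?_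
    push_cast
    nlinarith [K.coe_nonneg]
  calc eLpNorm Gw 2 μ ≤ _ :=
        hw.eLpNorm_le hε (isWeakGrad_correction (isOpen_square L) h₀ h₁ h₂ hH ε)
    _ ≤ eLpNorm (c • layerWeight L ε + (2 * (K : ℝ)) • fun x => ‖H x‖) 2 μ :=
        eLpNorm_mono_ae hpt
    _ ≤ eLpNorm (c • layerWeight L ε) 2 μ + eLpNorm ((2 * (K : ℝ)) • fun x => ‖H x‖) 2 μ :=
        eLpNorm_add_le (hlm.const_smul c) (hH2.1.norm.const_smul _) one_le_two
    _ ≤ ((48 * K : ℝ≥0) : ℝ≥0∞) * (1 + eLpNorm G ∞ μ) +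
          ((48 * K : ℝ≥0) : ℝ≥0∞) * eLpNorm H 2 μ := by
        refine add_le_add (hcw.trans hKm) ?_
        rw [eLpNorm_const_smul, eLpNorm_norm]
        exact mul_le_mul_left hK2 _
    _ = _ := by rw [← mul_add]

end RoughBoundary

theorem mainTheorem5 (γ g : ℝ → ℝ)
    (hγ_smooth : ContDiff ℝ ∞ γ) (hγ_per : Function.Periodic γ 1) (hγ_nonneg : ∀ t, 0 ≤ γ t)
    (hg_smooth : ContDiff ℝ ∞ g) (hg_per : Function.Periodic g 1)
    (β₀ β₁ β₂ : Plane → ℝ) (hβ : AreCellSolutions γ g β₀ β₁ β₂) :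
    ∃ C : ℝ≥0, 0 < C ∧
      ∀ (L ε : ℝ), 0 < L → 0 < ε →
      ∀ (f d u₀ : Plane → ℝ) (G₀ Gd : Plane → Plane)
        (H₀ : Plane → PiLp 2 (fun _ : Fin 2 => Plane)),
        MemLp f 2 (volume.restrict (square L)) →
        MemH1 (square L) d Gd →
        IsHomogenized L (arcLen γ * meanFlux γ g) f d u₀ G₀ →
        IsWeakHessian (square L) G₀ H₀ →
        MemLp G₀ ∞ (volume.restrict (square L)) →
        MemLp H₀ 2 (volume.restrict (square L)) →
      ∀ (ucr : Plane → ℝ) (Gcr : Plane → Plane),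
        IsCorrector L (firstCorrection γ ε β₀ β₁ β₂ G₀) ucr Gcr →
        eLpNorm Gcr 2 (volume.restrict (square L)) ≤
          C * (1 + eLpNorm G₀ ∞ (volume.restrict (square L))
            + eLpNorm H₀ 2 (volume.restrict (square L))) := by
  obtain ⟨K₀, h₀⟩ := hβ.zero.exists_isDecaying hγ_smooth hγ_per hγ_nonneg
  obtain ⟨K₁, h₁⟩ := hβ.one.exists_isDecaying hγ_smooth hγ_per hγ_nonneg
  obtain ⟨K₂, h₂⟩ := hβ.two.exists_isDecaying hγ_smooth hγ_per hγ_nonneg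
  -- the added `1` makes the constant positive
  have hK₀ : K₀ ≤ K₀ + K₁ + K₂ + 1 := by rw [add_assoc, add_assoc]; exact le_self_add
  have hK₁ : K₁ ≤ K₀ + K₁ + K₂ + 1 := by
    rw [add_assoc, add_comm K₀, add_assoc]; exact le_self_add
  have hK₂ : K₂ ≤ K₀ + K₁ + K₂ + 1 := by
    rw [add_comm (K₀ + K₁), add_assoc]; exact le_self_add
  refine ⟨48 * (K₀ + K₁ + K₂ + 1), by positivity, ?_⟩
  intro L ε hL hε f d u₀ G₀ Gd H₀ _ _ _ hH hG hH2 ucr Gcr hcr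
  exact hcr.eLpNorm_le_of_isDecaying hL hε (h₀.mono hK₀) (h₁.mono hK₁) (h₂.mono hK₂) hH hG hH2
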